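/- Let $K$ be a field of characteristic zero and let $A_n(K)$ be the Weyl algebra of differential operators on $K[x_1,\dots,x_n]$ generated by $x_1,\dots,x_n$ and $\partial_1,\dots,\partial_n$, where $\partial_i=\partial/\partial x_i$. Let the set of variables $\{x_1,\dots,x_n\}$ be partitioned into $p$ blocks of sizes $n_1,\dots,n_p\ge 0$, so that $n_1+\dots+n_p=n$. The $j$-th order of a monomial $x^\alpha\partial^\beta$ is the sum of $\alpha_k+\beta_k$ over all $k$ such that $x_k$ lies in the $j$-th block. For $(r_1,\dots,r_p)\in\mathbb Z^p$, let $W_{r_1,\dots,r_p}$ be the $K$-linear span of all monomials $x^\alpha\partial^\beta$ whose $j$-th order is at most $r_j$ for every $j$. Let $M$ be a nonzero left $A_n(K)$-module generated by $f_1,\dots,f_m$, and put $M_{r_1,\dots,r_p}=\sum_{i=1}^m W_{r_1,\dots,r_p}f_i$. Then there is a nonzero polynomial $\phi_M\in\mathbb Q[t_1,\dots,t_p]$ which is numerical (it takes integer values at all sufficiently large integer points $(r_1,\dots,r_p)$, i.e. there is $s\in\mathbb Z^p$ such that this holds whenever $r_i\ge s_i$ for all $i$) and has the following properties. (i) For all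 sufficiently large $(r_1,\dots,r_p)\in\mathbb Z^p$, the space $M_{r_1,\dots,r_p}$ is finite-dimensional over $K$ and $\phi_M(r_1,\dots,r_p)=\dim_K M_{r_1,\dots,r_p}$. (ii) $n_i\le\deg_{t_i}\phi_M\le 2n_i$ for $1\le i\le p$; the total degree satisfies $n\le\deg\phi_M\le 2n$; and $$\phi_M(t_1,\dots,t_p)=\sum_{i_1=0}^{2n_1}\dots\sum_{i_p=0}^{2n_p}a_{i_1\dots i_p}\binom{t_1+i_1}{i_1}\cdots\binom{t_p+i_p}{i_p}$$ for some integers $a_{i_1\dots i_p}$, where $\binom{t+k}{k}=\frac{(t+1)\cdots(t+k)}{k!}$. (iii) $M$ is holonomic if and only if $\deg\phi_M=n$. Here $M$ is called holonomic if it has a finite system of generators $g_1,\dots,g_q$ whose Bernstein polynomial has degree $n$; the Bernstein polynomial is the polynomial $\psi\in\mathbb Q[t]$ with $\psi(r)=\dim_K\sum_{i=1}^q W_r g_i$ for all sufficiently large integers $r$, where $W_r$ is the $K$-span of the monomials $x^\alpha\partial^\beta$ with $|\alpha|+|\beta|\le r$. -/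

import Mathlib

noncomputable section

/-- The Weyl algebra `A_n(K)`, as the `K`-algebra of differential operators on `K[x_1, …, x_n]`
generated by the multiplications by the variables and the partial differentiations
(`K` is a field of characteristic zero wherever this is used). -/
def weylSubalgebra (K : Type*) [Field K] (n : ℕ) :
    Subalgebra K (Module.End K (MvPolynomial (Fin n) K)) :=
  Algebra.adjoin K
    (Set.range (fun k : Fin n => LinearMap.mulLeft K (MvPolynomial.X k : MvPolynomial (Fin n) K)) ∪
      Set.range (fun k : Fin n =>
        ((MvPolynomial.pderiv k : Derivation K (MvPolynomial (Fin n) K) (MvPolynomial (Fin n) K)) :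
          MvPolynomial (Fin n) K →ₗ[K] MvPolynomial (Fin n) K)))

/-- The Weyl algebra as a type; a `D`-module is a (left) module over it. -/
abbrev WeylAlgebra (K : Type*) [Field K] (n : ℕ) : Type _ := ↥(weylSubalgebra K n)

namespace WeylAlgebra

variable (K : Type*) [Field K] {n : ℕ}

/-- The generator `x_k`: multiplication by the `k`-th variable. -/
def x (k : Fin n) : WeylAlgebra K n :=
  ⟨LinearMap.mulLeft K (MvPolynomial.X k : MvPolynomial (Fin n) K),
    Algebra.subset_adjoin (Or.inl ⟨k, rfl⟩)⟩

/-- The generator `∂_k`: partial differentiation with respect to the `k`-th variable. -/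
def d (k : Fin n) : WeylAlgebra K n :=
  ⟨((MvPolynomial.pderiv k : Derivation K (MvPolynomial (Fin n) K) (MvPolynomial (Fin n) K)) :
      MvPolynomial (Fin n) K →ₗ[K] MvPolynomial (Fin n) K),
    Algebra.subset_adjoin (Or.inr ⟨k, rfl⟩)⟩

/-- The monomial `x^α ∂^β = x_1^{α_1} ⋯ x_n^{α_n} ∂_1^{β_1} ⋯ ∂_n^{β_n}`. -/
def monomial (α β : Fin n → ℕ) : WeylAlgebra K n :=
  (List.ofFn fun k => x K k ^ α k).prod * (List.ofFn fun k => d K k ^ β k).prod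

/-- The order `|α| + |β|` of the monomial `x^α ∂^β`. -/
def ord (α β : Fin n → ℕ) : ℕ := ∑ k, (α k + β k)

/-- For a partition of the variables into `p` blocks, given by the map `b` that sends the index of
a variable to the index of its block, the `j`-th order `∑_{k in block j} (α_k + β_k)` of the
monomial `x^α ∂^β`. -/
def blockOrd {p : ℕ} (b : Fin n → Fin p) (j : Fin p) (α β : Fin n → ℕ) : ℕ :=
  ∑ k with b k = j, (α k + β k)

/-- The Bernstein filtration: `W_r` is spanned over `K` by the monomials of order at most `r`
(so it is `0` for `r < 0`). -/
def bernsteinW (n : ℕ) (r : ℤ) : Submodule K (WeylAlgebra K n) :=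
  Submodule.span K {D | ∃ α β : Fin n → ℕ, (ord α β : ℤ) ≤ r ∧ D = monomial K α β}

/-- The `p`-dimensional filtration: `W_{r_1,…,r_p}` is spanned over `K` by the monomials whose
`j`-th order is at most `r_j` for every `j` (so it is `0` if some `r_j` is negative). -/
def multiW {p : ℕ} (b : Fin n → Fin p) (r : Fin p → ℤ) : Submodule K (WeylAlgebra K n) :=
  Submodule.span K
    {D | ∃ α β : Fin n → ℕ, (∀ j, (blockOrd b j α β : ℤ) ≤ r j) ∧ D = monomial K α β}

variable {M : Type*} [AddCommGroup M] [Module (WeylAlgebra K n) M] [Module K M]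
  [IsScalarTower K (WeylAlgebra K n) M]

/-- For a `K`-subspace `W` of `A_n(K)` and `f_1, …, f_m ∈ M`, the `K`-subspace `∑_i W f_i`. -/
def sumSmul {m : ℕ} (W : Submodule K (WeylAlgebra K n)) (f : Fin m → M) : Submodule K M :=
  ⨆ i, W.map ((LinearMap.toSpanSingleton (WeylAlgebra K n) M (f i)).restrictScalars K)

/-- `M_{r_1,…,r_p} = ∑_i W_{r_1,…,r_p} f_i`. -/
def multiM {p m : ℕ} (b : Fin n → Fin p) (f : Fin m → M) (r : Fin p → ℤ) : Submodule K M :=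
  sumSmul K (multiW K b r) f

/-- `ψ` is the Bernstein polynomial of the module with respect to `g_1, …, g_m`:
`ψ(r) = dim_K (∑_i W_r g_i)` for all sufficiently large integers `r`. -/
def IsBernsteinPolynomial {m : ℕ} (g : Fin m → M) (ψ : Polynomial ℚ) : Prop :=
  ∃ r₀ : ℤ, ∀ r : ℤ, r₀ ≤ r →
    ψ.eval (r : ℚ) = (Module.finrank K ↥(sumSmul K (bernsteinW K n r) g) : ℚ)

variable (n M) in
/-- `M` is holonomic (belongs to the Bernstein class): it is finitely generated, and the Bernstein
polynomial associated with a finite system of generators has degree `n`. -/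
def IsHolonomic : Prop :=
  ∃ (m : ℕ) (g : Fin m → M), Submodule.span (WeylAlgebra K n) (Set.range g) = ⊤ ∧
    ∃ ψ : Polynomial ℚ, IsBernsteinPolynomial K (n := n) g ψ ∧ ψ.degree = (n : WithBot ℕ)

end WeylAlgebra

/-- A polynomial over `ℚ` in `p` variables is numerical if its values at all sufficiently large
integer points are integers. -/
def IsNumerical {p : ℕ} (φ : MvPolynomial (Fin p) ℚ) : Prop :=
  ∃ s : Fin p → ℤ, ∀ r : Fin p → ℤ, s ≤ r →
    ∃ z : ℤ, MvPolynomial.eval (fun i => (r i : ℚ)) φ = (z : ℚ)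

/-- The polynomial `binom (t_i + k) k = (t_i + 1) ⋯ (t_i + k) / k!` in `ℚ[t_1, …, t_p]`. -/
def binomPoly {p : ℕ} (i : Fin p) (k : ℕ) : MvPolynomial (Fin p) ℚ :=
  MvPolynomial.C ((k.factorial : ℚ)⁻¹) *
    ∏ j ∈ Finset.range k, (MvPolynomial.X i + MvPolynomial.C ((j : ℚ) + 1))

/-- The size of the `i`-th block of a partition given by its block map. -/
def blockSize {n p : ℕ} (b : Fin n → Fin p) (i : Fin p) : ℕ :=
  (Finset.univ.filter fun k => b k = i).card

end

/-!
Fix a monomial order and call a vector `x^α ∂^β f_i` reducible at level `r` if it is a combination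
of preceding vectors of multidegree at most `r`. The irreducible vectors of multidegree at most `r`
form a basis of `M_r`. Recording the slack `r - multidegree` along with `(α, β)` turns the reducible
vectors into an upper set, which is finitely generated by Dickson's lemma, so inclusion–exclusion
counts the irreducible ones as an integer combination of products of binomial coefficients.

For the lower degree bounds, Bernstein's argument embeds `W_r` into `Hom_K(M_r, M_{2r})`, because
an operator of positive order does not commute with all `x_k` and `∂_k`; hence
`dim W_r ≤ dim M_r * dim M_{2r}`, which is compared along the rays `r = q v`. Finally, the
multifiltration by `f` at `r` lies in the Bernstein filtration by any other generators `g` at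
`r_1 + ⋯ + r_p + t`, and the latter at `q` lies in the former at `s + (q, …, q)`, so the Bernstein
polynomial of `g` has the total degree of `φ`.
-/

noncomputable section

section Binomial

open Filter

variable {p : ℕ} {N : Fin p → ℕ}

theorem eval_binomPoly (i : Fin p) (k : ℕ) (r : Fin p → ℕ) :
    MvPolynomial.eval (fun j => (r j : ℚ)) (binomPoly i k) = ((r i + k).choose k : ℚ) := by
  rw [binomPoly, map_mul, MvPolynomial.eval_C, map_prod, inv_mul_eq_iff_eq_mul₀ (by positivity),
    ← Nat.cast_mul, ← Nat.ascFactorial_eq_factorial_mul_choose, Nat.ascFactorial_eq_prod_range,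
    Nat.cast_prod]
  refine Finset.prod_congr rfl fun j _ => ?_
  rw [map_add, MvPolynomial.eval_X, MvPolynomial.eval_C]
  push_cast
  ring

theorem degreeOf_binomPoly_le (i j : Fin p) (k : ℕ) :
    (binomPoly i k).degreeOf j ≤ if j = i then k else 0 := by
  refine (MvPolynomial.degreeOf_C_mul_le _ _ _).trans <|
    (MvPolynomial.degreeOf_prod_le _ _ _).trans ?_
  calc _ ≤ ∑ _l ∈ Finset.range k, if j = i then 1 else 0 := by
        refine Finset.sum_le_sum fun l _ => (MvPolynomial.degreeOf_add_le _ _ _).trans ?_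
        rw [MvPolynomial.degreeOf_C, MvPolynomial.degreeOf_X, max_eq_left (Nat.zero_le _)]
    _ = _ := by simp

/-- The `ℤ`-module of integer combinations of the products `∏ i, binom (t_i + k_i) k_i` with
`k ≤ N`. -/
def binomSpan (N : Fin p → ℕ) : Submodule ℤ (MvPolynomial (Fin p) ℚ) :=
  Submodule.span ℤ ((fun k : Fin p → ℕ => ∏ i, binomPoly i (k i)) ''
    (Fintype.piFinset fun i => Finset.range (N i + 1)))

theorem mem_binomSpan_iff {φ : MvPolynomial (Fin p) ℚ} :
    φ ∈ binomSpan N ↔ ∃ a : (Fin p → ℕ) → ℤ,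
      φ = ∑ k ∈ Fintype.piFinset (fun i => Finset.range (N i + 1)),
        MvPolynomial.C (a k : ℚ) * ∏ i, binomPoly i (k i) := by
  rw [binomSpan, Submodule.mem_span_image_finset_iff_exists_fun']
  simp only [zsmul_eq_mul, map_intCast, eq_comm (b := φ)]

theorem degreeOf_le_of_mem_binomSpan {φ : MvPolynomial (Fin p) ℚ} (hφ : φ ∈ binomSpan N)
    (j : Fin p) : φ.degreeOf j ≤ N j := by
  obtain ⟨a, rfl⟩ := mem_binomSpan_iff.1 hφ
  refine (MvPolynomial.degreeOf_sum_le _ _ _).trans (Finset.sup_le fun k hk => ?_)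
  calc _ ≤ ∑ i, if j = i then k i else 0 :=
        (MvPolynomial.degreeOf_C_mul_le _ _ _).trans <|
          (MvPolynomial.degreeOf_prod_le _ _ _).trans <|
            Finset.sum_le_sum fun i _ => degreeOf_binomPoly_le i j (k i)
    _ = k j := by simp
    _ ≤ N j := Nat.le_of_lt_succ (Finset.mem_range.1 (Fintype.mem_piFinset.1 hk j))

theorem totalDegree_le_sum_degreeOf {σ R : Type*} [Fintype σ] [CommSemiring R]
    (φ : MvPolynomial σ R) : φ.totalDegree ≤ ∑ i, φ.degreeOf i :=
  Finset.sup_le fun e he => by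
    rw [Finsupp.sum_fintype _ _ fun _ => rfl]
    exact Finset.sum_le_sum fun i _ => MvPolynomial.monomial_le_degreeOf i he

/-- The integer-valued functions on `ℕ^p` that agree with an element of `binomSpan N` for all
large arguments. -/
def eventuallyBinomial (N : Fin p → ℕ) : Submodule ℤ ((Fin p → ℕ) → ℤ) where
  carrier := {h | ∃ φ ∈ binomSpan N,
    ∀ᶠ r : Fin p → ℕ in atTop, MvPolynomial.eval (fun i => (r i : ℚ)) φ = h r}
  zero_mem' := ⟨0, zero_mem _, .of_forall fun r => by simp⟩
  add_mem' := by
    rintro h₁ h₂ ⟨φ₁, hφ₁, e₁⟩ ⟨φ₂, hφ₂, e₂⟩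
    refine ⟨φ₁ + φ₂, add_mem hφ₁ hφ₂, ?_⟩
    filter_upwards [e₁, e₂] with r hr₁ hr₂
    simp [hr₁, hr₂]
  smul_mem' := by
    rintro a h ⟨φ, hφ, e⟩
    refine ⟨a • φ, Submodule.smul_mem _ a hφ, ?_⟩
    filter_upwards [e] with r hr
    simp [hr]

theorem mem_eventuallyBinomial_congr {h₁ h₂ : (Fin p → ℕ) → ℤ} (h : h₁ =ᶠ[atTop] h₂)
    (H : h₁ ∈ eventuallyBinomial N) : h₂ ∈ eventuallyBinomial N := by
  obtain ⟨φ, hφ, e⟩ := H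
  exact ⟨φ, hφ, by filter_upwards [e, h] with r hr hr' using hr.trans (by rw [hr'])⟩

-- Pascal's rule lowers the translation `d` by one.
theorem exists_choose_sub_eq_sum (N d : ℕ) : ∃ c : ℕ → ℤ, ∀ t, d ≤ t →
    ((t - d + N).choose N : ℤ) = ∑ k ∈ Finset.range (N + 1), c k * ((t + k).choose k : ℤ) := by
  induction d generalizing N with
  | zero =>
    refine ⟨Pi.single N 1, fun t _ => ?_⟩
    rw [Finset.sum_eq_single N] <;> simp +contextual
  | succ d ih =>
    cases N with
    | zero => exact ⟨1, fun t _ => by simp⟩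
    | succ N =>
      obtain ⟨c₁, h₁⟩ := ih (N + 1)
      obtain ⟨c₂, h₂⟩ := ih N
      refine ⟨c₁ - fun k => if k < N + 1 then c₂ k else 0, fun t ht => ?_⟩
      have pascal : ((t - d + (N + 1)).choose (N + 1) : ℤ) =
          (t - d + N).choose N + (t - (d + 1) + (N + 1)).choose (N + 1) := by
        rw [← Nat.cast_add, ← add_assoc, Nat.choose_succ_succ,
          show t - (d + 1) + (N + 1) = t - d + N by omega]
      have restrict : ∑ k ∈ Finset.range (N + 1),
          (if k < N + 1 then c₂ k else 0) * ((t + k).choose k : ℤ) =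
          ∑ k ∈ Finset.range (N + 1), c₂ k * ((t + k).choose k : ℤ) :=
        Finset.sum_congr rfl fun k hk => by rw [if_pos (Finset.mem_range.1 hk)]
      simp only [Pi.sub_apply, sub_mul, Finset.sum_sub_distrib]
      rw [Finset.sum_range_succ (fun k => (if k < N + 1 then c₂ k else 0) * _), restrict,
        if_neg (lt_irrefl _), zero_mul, add_zero, ← h₁ t (by omega), ← h₂ t (by omega), pascal,
        add_sub_cancel_left]

theorem prod_choose_sub_mem_eventuallyBinomial (N d : Fin p → ℕ) :
    (fun r => ∏ i, ((r i - d i + N i).choose (N i) : ℤ)) ∈ eventuallyBinomial N := by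
  choose c hc using fun i => exists_choose_sub_eq_sum (N i) (d i)
  refine ⟨∑ k ∈ Fintype.piFinset (fun i => Finset.range (N i + 1)),
    MvPolynomial.C ((∏ i, c i (k i) : ℤ) : ℚ) * ∏ i, binomPoly i (k i),
    mem_binomSpan_iff.2 ⟨_, rfl⟩, ?_⟩
  filter_upwards [eventually_ge_atTop d] with r hr
  rw [Finset.prod_congr rfl fun i _ => hc i (r i) (hr i), Finset.prod_univ_sum]
  simp [eval_binomPoly, Finset.prod_mul_distrib]

end Binomial

section Multidegree

variable {V B : Type*} [Fintype V] [DecidableEq B]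

/-- The multidegree of an exponent when the variables `V` are sorted into blocks by `c : V → B`:
its `j`-th component is the degree in the variables of the `j`-th block. -/
def multidegree (c : V → B) : (V →₀ ℕ) →+ (B → ℕ) where
  toFun e j := ∑ w with c w = j, e w
  map_zero' := by ext; simp
  map_add' e e' := by ext; simp [Finset.sum_add_distrib]

theorem multidegree_apply (c : V → B) (e : V →₀ ℕ) (j : B) :
    multidegree c e j = ∑ w with c w = j, e w := rfl

theorem multidegree_single (c : V → B) (w : V) (k : ℕ) :
    multidegree c (Finsupp.single w k) = Pi.single (c w) k := by
  classical
  ext j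
  simp only [multidegree_apply, Finsupp.single_apply, Finset.sum_ite_eq, Finset.mem_filter_univ,
    Pi.single_apply, eq_comm (a := c w)]

theorem multidegree_mono (c : V → B) : Monotone (multidegree c) :=
  fun _ _ h _ => Finset.sum_le_sum fun w _ => h w

theorem le_multidegree (c : V → B) (e : V →₀ ℕ) (w : V) : e w ≤ multidegree c e (c w) :=
  Finset.single_le_sum (f := e) (fun _ _ => Nat.zero_le _) (by simp)

theorem sum_multidegree [Fintype B] (c : V → B) (e : V →₀ ℕ) :
    ∑ j, multidegree c e j = e.degree := by
  simp only [multidegree_apply, Finset.sum_fiberwise, Finsupp.degree_eq_sum]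

/-- The finite set of exponents of multidegree at most `r`. -/
def exponentsLE (c : V → B) (r : B → ℕ) : Finset (V →₀ ℕ) :=
  open scoped Classical in
  (Finset.Iic (Finsupp.equivFunOnFinite.symm (r ∘ c))).filter fun e => multidegree c e ≤ r

theorem mem_exponentsLE {c : V → B} {r : B → ℕ} {e : V →₀ ℕ} :
    e ∈ exponentsLE c r ↔ multidegree c e ≤ r := by
  simp only [exponentsLE, Finset.mem_filter, Finset.mem_Iic, and_iff_right_iff_imp]
  exact fun h w => (le_multidegree c e w).trans (h (c w))

theorem card_degree_le (T : Type*) [Fintype T] (k : ℕ) :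
    Nat.card {e : T →₀ ℕ // e.degree ≤ k} = (k + Fintype.card T).choose (Fintype.card T) := by
  classical
  have hmem (e : T →₀ ℕ) : e ∈ (Finset.range (k + 1)).biUnion (Finset.univ.finsuppAntidiag ·) ↔
      e.degree ≤ k := by
    simp [Finsupp.degree_eq_sum]
  rw [Nat.subtype_card _ hmem, Finset.card_biUnion]
  · simp only [Finset.card_finsuppAntidiag_nat_eq_multichoose, Finset.card_univ,
      Nat.sum_range_multichoose]
  · intro i _ j _ hij
    refine Finset.disjoint_left.2 fun e hi hj => hij ?_
    rw [Finset.mem_finsuppAntidiag] at hi hj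
    exact hi.1.symm.trans hj.1

theorem card_exponentsLE [Fintype B] (c : V → B) (r : B → ℕ) : (exponentsLE c r).card =
    ∏ j, (r j + (Finset.univ.filter fun w => c w = j).card).choose
      (Finset.univ.filter fun w => c w = j).card := by
  let split : {e : V →₀ ℕ // multidegree c e ≤ r} ≃
      ∀ j, {e : {w // c w = j} →₀ ℕ // e.degree ≤ r j} :=
    (((Finsupp.equivCongrLeft (Equiv.sigmaFiberEquiv c).symm).trans
      Finsupp.sigmaFinsuppEquivPiFinsupp).subtypeEquiv fun e => forall_congr' fun j => by
        rw [multidegree_apply, Finset.sum_subtype _ (p := fun w => c w = j) (by simp),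
          Finsupp.degree_eq_sum]
        rfl).trans Equiv.subtypePiEquivPi
  rw [← Nat.subtype_card (p := fun e => multidegree c e ≤ r) _ fun e => mem_exponentsLE,
    Nat.card_congr split, Nat.card_pi]
  simp only [card_degree_le, Fintype.card_subtype]

theorem filter_exponentsLE_ge (c : V → B) (r s : B → ℕ) (d : V →₀ ℕ)
    [DecidablePred fun e => s ≤ r - multidegree c e ∧ d ≤ e] (hr : s + multidegree c d ≤ r) :
    (exponentsLE c r).filter (fun e => s ≤ r - multidegree c e ∧ d ≤ e) =
      (exponentsLE c (r - (s + multidegree c d))).map (addRightEmbedding d) := by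
  ext e
  simp only [Finset.mem_filter, mem_exponentsLE, Finset.mem_map, addRightEmbedding_apply]
  constructor
  · rintro ⟨her, hs, hd⟩
    refine ⟨e - d, le_tsub_of_add_le_right ?_, tsub_add_cancel_of_le hd⟩
    rw [add_left_comm, ← map_add, tsub_add_cancel_of_le hd]
    exact add_le_of_le_tsub_right_of_le her hs
  · rintro ⟨e, he, rfl⟩
    have key : multidegree c e + (s + multidegree c d) ≤ r := add_le_of_le_tsub_right_of_le hr he
    rw [add_left_comm, ← map_add] at key
    exact ⟨le_of_add_le_right key, le_tsub_of_add_le_right key, le_add_self⟩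

theorem card_filter_forall_not {α ι : Type*} (E : Finset α) (G : Finset ι) (P : ι → α → Prop)
    [∀ i a, Decidable (P i a)] :
    ((E.filter fun a => ∀ i ∈ G, ¬ P i a).card : ℤ) =
      ∑ t ∈ G.powerset, (-1) ^ t.card * ((E.filter fun a => ∀ i ∈ t, P i a).card : ℤ) := by
  classical
  have expand (a : α) : (if ∀ i ∈ G, ¬ P i a then 1 else 0 : ℤ) =
      ∑ t ∈ G.powerset, (-1) ^ t.card * if ∀ i ∈ t, P i a then 1 else 0 := by
    have := Finset.prod_sub (fun _ => (1 : ℤ)) (fun i => if P i a then 1 else 0) G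
    simp only [Finset.prod_const_one, mul_one, Finset.prod_boole] at this
    rw [← this, ← Finset.prod_boole]
    exact Finset.prod_congr rfl fun i _ => by split_ifs <;> simp_all
  simp only [Finset.card_filter, Nat.cast_sum, Nat.cast_ite, Nat.cast_one, Nat.cast_zero,
    Finset.mul_sum, expand]
  exact Finset.sum_comm

theorem exists_finset_mem_iff_exists_le {α : Type*} [PartialOrder α] [WellQuasiOrderedLE α]
    {S : Set α} (hS : IsUpperSet S) : ∃ G : Finset α, ∀ a, a ∈ S ↔ ∃ g ∈ G, g ≤ a := by
  have hpwo := Set.isPWO_of_wellQuasiOrderedLE S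
  have hfin : {a | Minimal (· ∈ S) a}.Finite :=
    (setOfPred_minimal_antichain _).finite_of_partiallyWellOrderedOn
      (hpwo.mono (setOfPred_minimal_subset _))
  refine ⟨hfin.toFinset, fun a => ⟨fun ha => ?_, ?_⟩⟩
  · obtain ⟨g, hle, hg⟩ := hpwo.exists_le_minimal ha
    exact ⟨g, hfin.mem_toFinset.2 hg, hle⟩
  · rintro ⟨g, hg, hle⟩
    exact hS hle (hfin.mem_toFinset.1 hg).prop

open scoped Classical in
theorem card_exponentsLE_notMem_mem_eventuallyBinomial {p : ℕ} (c : V → Fin p)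
    {S : Set ((Fin p → ℕ) × (V →₀ ℕ))} (hS : IsUpperSet S) :
    (fun r => (((exponentsLE c r).filter fun e => (r - multidegree c e, e) ∉ S).card : ℤ)) ∈
      eventuallyBinomial fun j => (Finset.univ.filter fun w => c w = j).card := by
  obtain ⟨G, hG⟩ := exists_finset_mem_iff_exists_le hS
  have hcard : (fun r => (((exponentsLE c r).filter fun e =>
      (r - multidegree c e, e) ∉ S).card : ℤ)) = ∑ t ∈ G.powerset, (-1 : ℤ) ^ t.card • fun r =>
        (((exponentsLE c r).filter fun e => t.sup id ≤ (r - multidegree c e, e)).card : ℤ) := by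
    ext r
    simp only [hG, not_exists, not_and, card_filter_forall_not, Finset.sum_apply, Pi.smul_apply,
      smul_eq_mul, Finset.sup_le_iff, id]
  rw [hcard]
  refine sum_mem fun t _ => Submodule.smul_mem _ _ ?_
  obtain ⟨s, d⟩ := t.sup id
  refine mem_eventuallyBinomial_congr ?_
    (prod_choose_sub_mem_eventuallyBinomial _ (s + multidegree c d))
  filter_upwards [Filter.eventually_ge_atTop (s + multidegree c d)] with r hr
  simp only [Prod.mk_le_mk]
  rw [filter_exponentsLE_ge c r s d hr, Finset.card_map, card_exponentsLE]
  simp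

end Multidegree

section StandardVectors

open scoped Classical in
theorem finrank_span_image_eq_card_filter {K M E L : Type*} [DivisionRing K] [AddCommGroup M]
    [Module K M] [LinearOrder L] {key : E → L} (hkey : Function.Injective key) (v : E → M)
    (F : Finset E) : Module.finrank K (Submodule.span K (v '' F)) =
      (F.filter fun u => v u ∉ Submodule.span K (v '' {u' | u' ∈ F ∧ key u' < key u})).card := by
  induction F using Finset.induction_on_max_value key with
  | empty => rw [Finset.coe_empty, Set.image_empty, Submodule.span_empty, finrank_bot,
      Finset.filter_empty, Finset.card_empty]
  | insert a F ha hmax ih =>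
    have hlt (u : E) (hu : u ∈ F) : key u < key a :=
      (hmax u hu).lt_of_ne fun h => ha (hkey h ▸ hu)
    have below_max : {u | u ∈ insert a F ∧ key u < key a} = (F : Set E) := by
      ext u
      simp only [Finset.mem_insert, Set.mem_ofPred_eq, Finset.mem_coe]
      exact ⟨fun h => h.1.resolve_left (ne_of_apply_ne key h.2.ne), fun h => ⟨.inr h, hlt u h⟩⟩
    have below_old (u : E) (hu : u ∈ F) :
        {u' | u' ∈ insert a F ∧ key u' < key u} = {u' | u' ∈ F ∧ key u' < key u} := by
      ext u'
      simp only [Finset.mem_insert, Set.mem_ofPred_eq, or_and_right, or_iff_right_iff_imp]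
      rintro ⟨rfl, h⟩
      exact absurd h (hlt u hu).not_gt
    have : Module.Finite K (Submodule.span K (v '' (F : Set E))) :=
      Module.Finite.span_of_finite K (F.finite_toSet.image v)
    rw [Finset.filter_insert, below_max, Finset.filter_congr fun u hu => by rw [below_old u hu],
      Finset.coe_insert, Set.image_insert_eq, Submodule.span_insert, sup_comm]
    by_cases hva : v a ∈ Submodule.span K (v '' (F : Set E))
    · rw [if_neg (not_not.2 hva),
        sup_eq_left.2 ((Submodule.span_singleton_le_iff_mem _ _).2 hva), ih]
    · rw [if_pos hva, Finset.card_insert_of_notMem (by simp [ha]), ← ih]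
      have hdim := Submodule.finrank_sup_add_finrank_inf_eq
        (Submodule.span K (v '' (F : Set E))) (Submodule.span K {v a})
      rwa [(Submodule.disjoint_span_singleton_of_notMem hva).eq_bot, finrank_bot, add_zero,
        finrank_span_singleton fun h : v a = 0 => hva (h ▸ zero_mem _)] at hdim

end StandardVectors

section MonomialFamily

variable {K A V : Type*} [CommRing K] [Ring A] [Algebra K A] {mon : (V →₀ ℕ) → A}

variable (K mon) in
/-- The span of the members of the family `mon` whose exponent properly divides `e`. -/
def lowerTerms (e : V →₀ ℕ) : Submodule K A :=
  Submodule.span K (mon '' Set.Iio e)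

theorem mem_lowerTerms {e' e : V →₀ ℕ} (h : e' < e) : mon e' ∈ lowerTerms K mon e :=
  Submodule.subset_span ⟨e', h, rfl⟩

theorem lowerTerms_mono : Monotone (lowerTerms K mon) := fun _ _ h =>
  Submodule.span_mono (Set.image_mono (Set.Iio_subset_Iio h))

theorem map_mem_of_mem_lowerTerms {M : Type*} [AddCommGroup M] [Module K M] (T : A →ₗ[K] M)
    {P : Submodule K M} {e : V →₀ ℕ} (hT : ∀ e' < e, T (mon e') ∈ P) {l : A}
    (hl : l ∈ lowerTerms K mon e) : T l ∈ P :=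
  (Submodule.map_span_le T _ P).2 (Set.forall_mem_image.2 hT) (Submodule.mem_map_of_mem hl)

variable (K) in
/-- A family of elements of a `K`-algebra, indexed by exponents, that multiplies like the monomials
in commuting variables, up to lower terms. -/
def IsMonomialFamily (mon : (V →₀ ℕ) → A) : Prop :=
  ∀ d e, mon d * mon e - mon (d + e) ∈ lowerTerms K mon (d + e)

theorem mem_lowerTerms_of_sub_mem {y : A} {e' e : V →₀ ℕ} (h : e' < e)
    (hy : y - mon e' ∈ lowerTerms K mon e') : y ∈ lowerTerms K mon e := by
  simpa using add_mem (lowerTerms_mono h.le hy) (mem_lowerTerms h)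

theorem isMonomialFamily_of_gen_mul {gen : V → A} (one : mon 0 = 1)
    (gen_mul : ∀ v e, gen v * mon e - mon (Finsupp.single v 1 + e) ∈
      lowerTerms K mon (Finsupp.single v 1 + e)) :
    IsMonomialFamily K mon := by
  intro d
  induction d using WellFoundedLT.induction with
  | ind d ih =>
  intro e
  obtain rfl | hd := eq_or_ne d 0
  · simp [one]
  obtain ⟨v, hv⟩ := Finsupp.ne_iff.1 hd
  obtain ⟨d, rfl⟩ := exists_add_of_le (Finsupp.single_le_iff.2 (Nat.one_le_iff_ne_zero.2 hv))
  have hlt : d < Finsupp.single v 1 + d := lt_add_of_pos_left _ (by simp [pos_iff_ne_zero])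
  have gen_mul_lower : gen v * (mon d * mon e - mon (d + e)) ∈
      lowerTerms K mon (Finsupp.single v 1 + (d + e)) :=
    map_mem_of_mem_lowerTerms (LinearMap.mulLeft K (gen v))
      (fun e' he' => mem_lowerTerms_of_sub_mem (add_lt_add_right he' _) (gen_mul v e')) (ih d hlt e)
  have lower_mul : (gen v * mon d - mon (Finsupp.single v 1 + d)) * mon e ∈
      lowerTerms K mon (Finsupp.single v 1 + (d + e)) :=
    map_mem_of_mem_lowerTerms (LinearMap.mulRight K (mon e)) (fun d' hd' =>
      mem_lowerTerms_of_sub_mem ((add_lt_add_left hd' e).trans_eq (add_assoc _ _ _)) (ih d' hd' e))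
      (gen_mul v d)
  rw [add_assoc]
  convert sub_mem (add_mem gen_mul_lower (gen_mul v (d + e))) lower_mul using 1
  noncomm_ring

theorem IsMonomialFamily.adjoin_le_span (h : IsMonomialFamily K mon) (one : mon 0 = 1) {S : Set A}
    (hS : S ⊆ Set.range mon) :
    Subalgebra.toSubmodule (Algebra.adjoin K S) ≤ Submodule.span K (Set.range mon) := by
  have mon_mul_mem (d e : V →₀ ℕ) : mon d * mon e ∈ Submodule.span K (Set.range mon) :=
    (Submodule.sub_mem_iff_left _ (Submodule.subset_span (Set.mem_range_self (d + e)))).1 <|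
      Submodule.span_mono (Set.image_subset_range _ _) (h d e)
  have mul_le : Submodule.span K (Set.range mon) * Submodule.span K (Set.range mon) ≤
      Submodule.span K (Set.range mon) := by
    rw [Submodule.span_mul_span, Submodule.span_le]
    rintro _ ⟨_, ⟨d, rfl⟩, _, ⟨e, rfl⟩, rfl⟩
    exact mon_mul_mem d e
  exact Algebra.adjoin_le (S := (Submodule.span K (Set.range mon)).toSubalgebra
    (Submodule.subset_span ⟨0, one⟩) fun _ _ ha hb => mul_le (Submodule.mul_mem_mul ha hb))
    (hS.trans Submodule.subset_span)

end MonomialFamily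

section Filtration

variable {K A V B ι M : Type*} [CommRing K] [Ring A] [AddCommGroup M] [Module A M]

/-- The vector `x^e f_i`, for a family `mon` of elements `x^e` of the ring acting on the module. -/
def monVector (mon : (V →₀ ℕ) → A) (f : ι → M) (q : (V →₀ ℕ) × ι) : M := mon q.1 • f q.2

variable [Module K M] {mon : (V →₀ ℕ) → A} {f : ι → M}

section ScalarAction

variable [Algebra K A] [IsScalarTower K A M]

theorem map_lowerTerms_smul_mem {P : Set ((V →₀ ℕ) × ι)} {e : V →₀ ℕ} {i : ι}
    (hP : ∀ e' < e, (e', i) ∈ P) {l : A} (hl : l ∈ lowerTerms K mon e) :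
    l • f i ∈ Submodule.span K (monVector mon f '' P) :=
  map_mem_of_mem_lowerTerms ((LinearMap.toSpanSingleton A M (f i)).restrictScalars K)
    (P := Submodule.span K (monVector mon f '' P))
    (fun e' he' => Submodule.subset_span ⟨(e', i), hP e' he', rfl⟩) hl

theorem IsMonomialFamily.smul_mem_span_monVector
    (hmon : IsMonomialFamily K mon) (d : V →₀ ℕ) {P Q : Set ((V →₀ ℕ) × ι)}
    (hPQ : ∀ e i, (e, i) ∈ P → ∀ e' ≤ d + e, (e', i) ∈ Q) {y : M}
    (hy : y ∈ Submodule.span K (monVector mon f '' P)) :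
    mon d • y ∈ Submodule.span K (monVector mon f '' Q) := by
  refine (Submodule.map_span_le (Algebra.lsmul K K M (mon d)) _ _).2 ?_
    (Submodule.mem_map_of_mem hy)
  rintro _ ⟨⟨e, i⟩, he, rfl⟩
  have leading : mon (d + e) • f i ∈ Submodule.span K (monVector mon f '' Q) :=
    Submodule.subset_span (Set.mem_image_of_mem _ (hPQ e i he _ le_rfl))
  have lower : (mon d * mon e - mon (d + e)) • f i ∈ Submodule.span K (monVector mon f '' Q) :=
    map_lowerTerms_smul_mem (fun e' he' => hPQ e i he _ he'.le) (hmon d e)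
  simpa [monVector, sub_smul, mul_smul] using add_mem lower leading

end ScalarAction

variable [Fintype V] [DecidableEq B]

variable (K) in
/-- The multifiltration of the module generated by the `f i`: the span of the vectors `x^e f_i`
with `x^e` of multidegree at most `r`. -/
def filtration (mon : (V →₀ ℕ) → A) (c : V → B) (f : ι → M) (r : B → ℕ) : Submodule K M :=
  Submodule.span K (monVector mon f '' {q | multidegree c q.1 ≤ r})

theorem mon_smul_mem_filtration {c : V → B} {r : B → ℕ} {e : V →₀ ℕ} (he : multidegree c e ≤ r)
    (i : ι) : mon e • f i ∈ filtration K mon c f r :=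
  Submodule.subset_span ⟨(e, i), he, rfl⟩

theorem filtration_le {c : V → B} {r : B → ℕ} {P : Submodule K M} :
    filtration K mon c f r ≤ P ↔ ∀ e, multidegree c e ≤ r → ∀ i, mon e • f i ∈ P := by
  simp only [filtration, Submodule.span_le, Set.image_subset_iff]
  exact ⟨fun h e he i => h (a := (e, i)) he, fun h q hq => h q.1 hq q.2⟩

theorem filtration_mono (c : V → B) (f : ι → M) : Monotone (filtration K mon c f) :=
  fun _ _ h => filtration_le.2 fun _ he => mon_smul_mem_filtration (he.trans h)

theorem filtration_le_filtration_of_unique [Fintype B] {B' : Type*} [Unique B'] [DecidableEq B']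
    (c : V → B) (c' : V → B') (f : ι → M) (r : B → ℕ) :
    filtration K mon c f r ≤ filtration K mon c' f fun _ => ∑ j, r j :=
  filtration_le.2 fun e he => mon_smul_mem_filtration fun j => by
    calc multidegree c' e j = ∑ j, multidegree c e j := by
          rw [sum_multidegree, ← sum_multidegree c', Fintype.sum_unique, Subsingleton.elim j]
      _ ≤ ∑ j, r j := Finset.sum_le_sum fun j _ => he j

theorem filtration_unique_le_filtration [Finite B] {B' : Type*} [Unique B'] [DecidableEq B']
    (c : V → B) (c' : V → B') (f : ι → M) (r : ℕ) :
    filtration K mon c' f (fun _ => r) ≤ filtration K mon c f fun _ => r := by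
  cases nonempty_fintype B
  refine filtration_le.2 fun e he => mon_smul_mem_filtration fun j => ?_
  calc multidegree c e j ≤ ∑ j, multidegree c e j :=
        Finset.single_le_sum (fun _ _ => Nat.zero_le _) (Finset.mem_univ j)
    _ = multidegree c' e default := by
        rw [sum_multidegree, ← sum_multidegree c', Fintype.sum_unique]
    _ ≤ r := he default

instance finite_filtration [Finite ι] (c : V → B) (f : ι → M) (r : B → ℕ) :
    Module.Finite K (filtration K mon c f r) := by
  have hfin : {e | multidegree c e ≤ r}.Finite :=
    (exponentsLE c r).finite_toSet.subset fun _ => mem_exponentsLE.2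
  exact Module.Finite.span_of_finite K
    (((hfin.prod Set.finite_univ).subset fun q hq => ⟨hq, trivial⟩).image _)

variable [Algebra K A] [IsScalarTower K A M]

theorem IsMonomialFamily.smul_mem_filtration (hmon : IsMonomialFamily K mon) {c : V → B}
    {r : B → ℕ} {y : M} (hy : y ∈ filtration K mon c f r) (d : V →₀ ℕ) :
    mon d • y ∈ filtration K mon c f (r + multidegree c d) := by
  refine hmon.smul_mem_span_monVector d (fun e i he e' he' => ?_) hy
  calc multidegree c e' ≤ multidegree c d + multidegree c e :=
        (multidegree_mono c he').trans_eq (map_add _ _ _)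
    _ ≤ r + multidegree c d := (add_comm _ _).trans_le (add_le_add_left he _)

theorem exists_mem_filtration [Finite ι] (c : V → B) (hspan : Submodule.span K (Set.range mon) = ⊤)
    {y : M} (hy : y ∈ Submodule.span A (Set.range f)) : ∃ r, y ∈ filtration K mon c f r := by
  rw [← Submodule.mem_iSup_of_directed _ (filtration_mono c f).directed_le]
  have hmem (a : A) (i : ι) : a • f i ∈ ⨆ r, filtration K mon c f r := by
    have ha : a ∈ Submodule.span K (Set.range mon) := hspan ▸ Submodule.mem_top
    refine (Submodule.map_span_le ((LinearMap.toSpanSingleton A M (f i)).restrictScalars K) _ _).2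
      ?_ (Submodule.mem_map_of_mem ha)
    rintro _ ⟨e, rfl⟩
    exact Submodule.mem_iSup_of_mem _ (mon_smul_mem_filtration (c := c) le_rfl i)
  have := Fintype.ofFinite ι
  obtain ⟨a, rfl⟩ := (Submodule.mem_span_range_iff_exists_fun A).1 hy
  exact sum_mem fun i _ => hmem (a i) i

theorem IsMonomialFamily.exists_filtration_le [Finite ι] (hmon : IsMonomialFamily K mon)
    (c : V → B) (hspan : Submodule.span K (Set.range mon) = ⊤)
    (hf : Submodule.span A (Set.range f) = ⊤) {κ : Type*} [Finite κ] (g : κ → M) :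
    ∃ s, ∀ r, filtration K mon c g r ≤ filtration K mon c f (s + r) := by
  have hg (k : κ) : g k ∈ Submodule.span A (Set.range f) := hf ▸ Submodule.mem_top
  choose s hs using fun k => exists_mem_filtration c hspan (hg k)
  obtain ⟨t, ht⟩ := (Set.finite_range s).bddAbove
  exact ⟨t, fun r => filtration_le.2 fun e he k =>
    filtration_mono c f (add_le_add (ht ⟨k, rfl⟩) he) (hmon.smul_mem_filtration (hs k) e)⟩

end Filtration

section HilbertFunction

variable {V ι : Type*}

/-- The total order on the vectors `x^e f_i` that compares exponents first. -/
def vectorKey (o : MonomialOrder V) (q : (V →₀ ℕ) × ι) : o.syn ×ₗ ι := toLex (o.toSyn q.1, q.2)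

theorem vectorKey_injective (o : MonomialOrder V) :
    Function.Injective (vectorKey o : (V →₀ ℕ) × ι → _) :=
  toLex.injective.comp (o.toSyn.injective.prodMap Function.injective_id)

variable [LinearOrder ι]

theorem vectorKey_lt_of_lt (o : MonomialOrder V) {e' e : V →₀ ℕ} (h : e' < e) (j i : ι) :
    vectorKey o (e', j) < vectorKey o (e, i) :=
  Prod.Lex.toLex_lt_toLex.2 (.inl (o.toSyn_strictMono h))

theorem vectorKey_add_lt (o : MonomialOrder V) (d : V →₀ ℕ) {e' e : V →₀ ℕ} {j i : ι}
    (h : vectorKey o (e', j) < vectorKey o (e, i)) :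
    vectorKey o (d + e', j) < vectorKey o (d + e, i) := by
  simpa [vectorKey, Prod.Lex.toLex_lt_toLex, map_add] using h

theorem vectorKey_le_of_le (o : MonomialOrder V) {e' e : V →₀ ℕ} (h : e' ≤ e) (i : ι) :
    vectorKey o (e', i) ≤ vectorKey o (e, i) :=
  h.eq_or_lt.elim (fun h => h ▸ le_rfl) fun h => (vectorKey_lt_of_lt o h i i).le

variable [Fintype V] {p : ℕ}

/-- The vectors of multidegree at most `r` that precede `x^e f_i`, given by their indices. -/
def precedingVectors (o : MonomialOrder V) (c : V → Fin p) (r : Fin p → ℕ) (e : V →₀ ℕ) (i : ι) :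
    Set ((V →₀ ℕ) × ι) :=
  {q | multidegree c q.1 ≤ r ∧ vectorKey o q < vectorKey o (e, i)}

variable {K A M : Type*} [Field K] [Ring A] [AddCommGroup M] [Module A M] [Module K M]
  {mon : (V →₀ ℕ) → A}

variable (K) in
/-- The pairs `(s, e)` such that `x^e f_i` is a combination of preceding vectors of multidegree at
most `s + deg e`. The slack `s` plays the role of the exponents of homogenizing variables. -/
def reducibleExponents (o : MonomialOrder V) (mon : (V →₀ ℕ) → A) (c : V → Fin p) (f : ι → M)
    (i : ι) : Set ((Fin p → ℕ) × (V →₀ ℕ)) :=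
  {t | mon t.2 • f i ∈ Submodule.span K
    (monVector mon f '' precedingVectors o c (t.1 + multidegree c t.2) t.2 i)}

theorem IsMonomialFamily.isUpperSet_reducibleExponents [Algebra K A] [IsScalarTower K A M]
    (hmon : IsMonomialFamily K mon) (o : MonomialOrder V) (c : V → Fin p) (f : ι → M) (i : ι) :
    IsUpperSet (reducibleExponents K o mon c f i) := by
  rintro ⟨s, e⟩ ⟨s', e'⟩ ⟨hs, he⟩ hmem
  obtain ⟨d, rfl⟩ : ∃ d, e' = d + e := by
    simpa [add_comm] using exists_add_of_le he
  set Q := precedingVectors o c (s' + multidegree c (d + e)) (d + e) i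
  have multiple : mon d • mon e • f i ∈ Submodule.span K (monVector mon f '' Q) := by
    refine hmon.smul_mem_span_monVector d (Q := Q) (fun e₁ j he₁ e₂ he₂ => ⟨?_, ?_⟩) hmem
    · calc multidegree c e₂ ≤ multidegree c d + (s + multidegree c e) :=
            ((multidegree_mono c he₂).trans_eq (map_add _ _ _)).trans (add_le_add_right he₁.1 _)
        _ ≤ s' + multidegree c (d + e) := by
            rw [add_left_comm, ← map_add]
            exact add_le_add_left hs _
    · exact (vectorKey_le_of_le o he₂ j).trans_lt (vectorKey_add_lt o d he₁.2)
  have lower : (mon d * mon e - mon (d + e)) • f i ∈ Submodule.span K (monVector mon f '' Q) :=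
    map_lowerTerms_smul_mem (P := Q) (fun e₁ he₁ => ⟨(multidegree_mono c he₁.le).trans le_add_self,
      vectorKey_lt_of_lt o he₁ i i⟩) (hmon d e)
  rw [sub_smul, mul_smul] at lower
  exact (Submodule.sub_mem_iff_right _ multiple).1 lower

open scoped Classical in
theorem finrank_filtration_eq_sum_card [Fintype ι] (o : MonomialOrder V) (mon : (V →₀ ℕ) → A)
    (c : V → Fin p) (f : ι → M) (r : Fin p → ℕ) :
    Module.finrank K (filtration K mon c f r) = ∑ i, ((exponentsLE c r).filter fun e =>
      (r - multidegree c e, e) ∉ reducibleExponents K o mon c f i).card := by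
  have hset : {q : (V →₀ ℕ) × ι | multidegree c q.1 ≤ r} =
      ((exponentsLE c r ×ˢ Finset.univ : Finset ((V →₀ ℕ) × ι)) : Set _) := by
    ext q
    simp [mem_exponentsLE]
  have preceding (e : V →₀ ℕ) (i : ι) : {q | q ∈ exponentsLE c r ×ˢ Finset.univ ∧
      vectorKey o q < vectorKey o (e, i)} = precedingVectors o c r e i := by
    ext q
    simp [mem_exponentsLE, precedingVectors]
  rw [filtration, hset, finrank_span_image_eq_card_filter (vectorKey_injective o),
    Finset.card_filter, Finset.sum_product_right]
  refine Finset.sum_congr rfl fun i _ => ?_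
  rw [Finset.card_filter]
  refine Finset.sum_congr rfl fun e he => ?_
  simp only [preceding, reducibleExponents, Set.mem_ofPred_eq, monVector,
    tsub_add_cancel_of_le (mem_exponentsLE.1 he)]

theorem IsMonomialFamily.finrank_filtration_mem_eventuallyBinomial [Finite ι]
    [Algebra K A] [IsScalarTower K A M] (hmon : IsMonomialFamily K mon) (c : V → Fin p)
    (f : ι → M) :
    (fun r => (Module.finrank K (filtration K mon c f r) : ℤ)) ∈
      eventuallyBinomial fun j => (Finset.univ.filter fun w => c w = j).card := by
  classical
  cases nonempty_fintype ι
  let : LinearOrder V := LinearOrder.lift' _ (Fintype.equivFin V).injective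
  have hsum := sum_mem fun i (_ : i ∈ Finset.univ) =>
    card_exponentsLE_notMem_mem_eventuallyBinomial c
      (hmon.isUpperSet_reducibleExponents MonomialOrder.lex c f i)
  convert hsum using 1
  ext r
  simp only [finrank_filtration_eq_sum_card (MonomialOrder.lex (σ := V)), Finset.sum_apply,
    Nat.cast_sum]

end HilbertFunction

section CommutingEval

variable {K R σ : Type*} [CommRing K] [Ring R] [Algebra K R] {a : σ → R}

open scoped IsMulCommutative in
variable (K) in
/-- The evaluation of polynomials at a family of pairwise commuting elements of an algebra. -/
def commutingEval (a : σ → R) (ha : ∀ k l, Commute (a k) (a l)) : MvPolynomial σ K →ₐ[K] R :=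
  haveI := Algebra.isMulCommutative_adjoin K (s := Set.range a)
    (Set.forall_mem_range.2 fun k => Set.forall_mem_range.2 (ha k))
  (Algebra.adjoin K (Set.range a)).val.comp
    (MvPolynomial.aeval (S₁ := Algebra.adjoin K (Set.range a)) fun k =>
      ⟨a k, Algebra.subset_adjoin (Set.mem_range_self k)⟩)

theorem commutingEval_X (ha : ∀ k l, Commute (a k) (a l)) (k : σ) :
    commutingEval K a ha (MvPolynomial.X k) = a k := by
  simp [commutingEval]

theorem commutingEval_monomial {n : ℕ} {a : Fin n → R} (ha : ∀ k l, Commute (a k) (a l))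
    (α : Fin n →₀ ℕ) : commutingEval K a ha (MvPolynomial.monomial α 1) =
      (List.ofFn fun k => a k ^ α k).prod := by
  rw [MvPolynomial.monomial_eq, MvPolynomial.C_1, one_mul,
    Finsupp.prod_fintype _ _ fun _ => pow_zero _, ← List.prod_ofFn, map_list_prod, List.map_ofFn]
  simp only [Function.comp_def, map_pow, commutingEval_X]

theorem mul_commutingEval (ha : ∀ k l, Commute (a k) (a l))
    (D : Derivation K (MvPolynomial σ K) (MvPolynomial σ K)) {y : R}
    (hy : ∀ k, y * a k = a k * y + commutingEval K a ha (D (MvPolynomial.X k)))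
    (g : MvPolynomial σ K) :
    y * commutingEval K a ha g = commutingEval K a ha g * y + commutingEval K a ha (D g) := by
  induction g using MvPolynomial.induction_on with
  | C c =>
    rw [← MvPolynomial.algebraMap_eq, AlgHom.commutes, D.map_algebraMap, map_zero, add_zero,
      Algebra.commutes]
  | add g h hg hh => rw [map_add, mul_add, hg, hh, map_add, map_add, add_mul]; abel
  | mul_X g k hg =>
    rw [map_mul, ← mul_assoc, hg, Derivation.leibniz, map_add, commutingEval_X, add_mul, mul_assoc,
      hy, smul_eq_mul, smul_eq_mul, mul_comm _ (D g), map_mul, map_mul, commutingEval_X]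
    noncomm_ring

theorem commutingEval_mul (ha : ∀ k l, Commute (a k) (a l))
    (D : Derivation K (MvPolynomial σ K) (MvPolynomial σ K)) {y : R}
    (hy : ∀ k, a k * y = y * a k + commutingEval K a ha (D (MvPolynomial.X k)))
    (g : MvPolynomial σ K) :
    commutingEval K a ha g * y = y * commutingEval K a ha g + commutingEval K a ha (D g) := by
  have hneg := mul_commutingEval ha D (y := -y) (fun k => by rw [mul_neg, hy]; noncomm_ring) g
  rw [neg_mul, mul_neg, neg_eq_iff_eq_neg] at hneg
  rw [hneg]
  abel

end CommutingEval

section WeylRelations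

/-- The defining relations of the Weyl algebra, for elements `x_k` and `∂_k` of any ring. -/
structure WeylRelations {R : Type*} [Ring R] {n : ℕ} (x d : Fin n → R) : Prop where
  x_commute : ∀ k l, Commute (x k) (x l)
  d_commute : ∀ k l, Commute (d k) (d l)
  d_mul_x : ∀ k l, d k * x l = x l * d k + if k = l then 1 else 0

/-- The monomial `x^α ∂^β`, its two exponents being the restrictions of `e`. -/
def weylMonomial {R : Type*} [Monoid R] {n : ℕ} (x d : Fin n → R) (e : Fin n ⊕ Fin n →₀ ℕ) : R :=
  (List.ofFn fun k => x k ^ e (Sum.inl k)).prod * (List.ofFn fun k => d k ^ e (Sum.inr k)).prod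

theorem weylMonomial_zero {R : Type*} [Monoid R] {n : ℕ} (x d : Fin n → R) :
    weylMonomial x d 0 = 1 := by
  simp [weylMonomial]

variable {K R : Type*} [CommRing K] [Ring R] [Algebra K R] {n : ℕ} {x d : Fin n → R}

variable (K) in
/-- The linear map that reads a polynomial in `2n` variables as a differential operator, with all
`x_k` to the left of all `∂_k`. -/
def normalOrder (x d : Fin n → R) : MvPolynomial (Fin n ⊕ Fin n) K →ₗ[K] R :=
  (MvPolynomial.basisMonomials (Fin n ⊕ Fin n) K).constr K (weylMonomial x d)

theorem normalOrder_monomial (e : Fin n ⊕ Fin n →₀ ℕ) (a : K) :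
    normalOrder K x d (MvPolynomial.monomial e a) = a • weylMonomial x d e := by
  rw [← mul_one a, ← smul_eq_mul, ← MvPolynomial.smul_monomial, map_smul, smul_eq_mul, mul_one]
  exact congrArg _ (Module.Basis.constr_basis _ _ _ _)

namespace WeylRelations

variable (K) in
theorem weylMonomial_eq (h : WeylRelations x d) (e : Fin n ⊕ Fin n →₀ ℕ) : weylMonomial x d e =
    commutingEval K x h.x_commute
        (MvPolynomial.monomial (Finsupp.sumFinsuppEquivProdFinsupp e).1 1) *
      commutingEval K d h.d_commute
        (MvPolynomial.monomial (Finsupp.sumFinsuppEquivProdFinsupp e).2 1) := by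
  rw [commutingEval_monomial, commutingEval_monomial]
  rfl

variable (h : WeylRelations x d)
include h

theorem x_mul_weylMonomial (k : Fin n) (e : Fin n ⊕ Fin n →₀ ℕ) :
    x k * weylMonomial x d e = weylMonomial x d (Finsupp.single (Sum.inl k) 1 + e) := by
  rw [h.weylMonomial_eq ℤ, h.weylMonomial_eq ℤ, ← commutingEval_X (K := ℤ) h.x_commute k,
    ← mul_assoc, ← map_mul, MvPolynomial.X, MvPolynomial.monomial_mul, one_mul]
  congr 4 <;> ext <;> simp [Finsupp.single_apply]

theorem weylMonomial_mul_d (k : Fin n) (e : Fin n ⊕ Fin n →₀ ℕ) :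
    weylMonomial x d e * d k = weylMonomial x d (Finsupp.single (Sum.inr k) 1 + e) := by
  rw [h.weylMonomial_eq ℤ, h.weylMonomial_eq ℤ, ← commutingEval_X (K := ℤ) h.d_commute k, mul_assoc,
    ← map_mul, mul_comm _ (MvPolynomial.X k), MvPolynomial.X, MvPolynomial.monomial_mul, one_mul]
  congr 4 <;> ext <;> simp [Finsupp.single_apply]

theorem d_mul_weylMonomial (k : Fin n) (e : Fin n ⊕ Fin n →₀ ℕ) :
    d k * weylMonomial x d e = weylMonomial x d e * d k +
      e (Sum.inl k) • weylMonomial x d (e - Finsupp.single (Sum.inl k) 1) := by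
  have hd (g : MvPolynomial (Fin n) ℤ) :
      commutingEval ℤ d h.d_commute g * d k = d k * commutingEval ℤ d h.d_commute g := by
    rw [← commutingEval_X (K := ℤ) h.d_commute k, ← map_mul, mul_comm, map_mul]
  have hx := mul_commutingEval (K := ℤ) h.x_commute (MvPolynomial.pderiv k) (y := d k) fun l => by
    rw [h.d_mul_x, MvPolynomial.pderiv_X, Pi.single_apply, apply_ite (commutingEval ℤ _ _), map_one,
      map_zero]
    simp only [eq_comm]
  rw [h.weylMonomial_eq ℤ, ← mul_assoc, hx, add_mul, mul_assoc, mul_assoc, hd, add_right_inj,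
    MvPolynomial.pderiv_monomial, h.weylMonomial_eq ℤ, ← smul_mul_assoc, ← map_nsmul,
    MvPolynomial.smul_monomial]
  have lower : Finsupp.sumFinsuppEquivProdFinsupp (e - Finsupp.single (Sum.inl k) 1) =
      ((Finsupp.sumFinsuppEquivProdFinsupp e).1 - Finsupp.single k 1,
        (Finsupp.sumFinsuppEquivProdFinsupp e).2) :=
    Prod.ext (by ext; simp [Finsupp.single_apply]) (by ext; simp)
  simp [lower]

theorem weylMonomial_mul_x (k : Fin n) (e : Fin n ⊕ Fin n →₀ ℕ) :
    weylMonomial x d e * x k = x k * weylMonomial x d e +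
      e (Sum.inr k) • weylMonomial x d (e - Finsupp.single (Sum.inr k) 1) := by
  have hx (g : MvPolynomial (Fin n) ℤ) :
      x k * commutingEval ℤ x h.x_commute g = commutingEval ℤ x h.x_commute g * x k := by
    rw [← commutingEval_X (K := ℤ) h.x_commute k, ← map_mul, mul_comm, map_mul]
  have hd := commutingEval_mul (K := ℤ) h.d_commute (MvPolynomial.pderiv k) (y := x k) fun l => by
    rw [h.d_mul_x, MvPolynomial.pderiv_X, Pi.single_apply, apply_ite (commutingEval ℤ _ _), map_one,
      map_zero]
  rw [h.weylMonomial_eq ℤ, mul_assoc, hd, mul_add, ← mul_assoc, ← mul_assoc, hx, add_right_inj,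
    MvPolynomial.pderiv_monomial, h.weylMonomial_eq ℤ, ← mul_smul_comm, ← map_nsmul,
    MvPolynomial.smul_monomial]
  have lower : Finsupp.sumFinsuppEquivProdFinsupp (e - Finsupp.single (Sum.inr k) 1) =
      ((Finsupp.sumFinsuppEquivProdFinsupp e).1,
        (Finsupp.sumFinsuppEquivProdFinsupp e).2 - Finsupp.single k 1) :=
    Prod.ext (by ext; simp) (by ext; simp [Finsupp.single_apply])
  simp [lower]

theorem d_mul_normalOrder (k : Fin n) (g : MvPolynomial (Fin n ⊕ Fin n) K) :
    d k * normalOrder K x d g =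
      normalOrder K x d g * d k + normalOrder K x d (MvPolynomial.pderiv (Sum.inl k) g) := by
  induction g using MvPolynomial.induction_on' with
  | monomial e a =>
    rw [MvPolynomial.pderiv_monomial, normalOrder_monomial, normalOrder_monomial, mul_smul_comm,
      h.d_mul_weylMonomial, smul_add, smul_mul_assoc, mul_smul, Nat.cast_smul_eq_nsmul]
  | add g g' hg hg' => rw [map_add, map_add, map_add, mul_add, add_mul, hg, hg']; abel

theorem normalOrder_mul_x (k : Fin n) (g : MvPolynomial (Fin n ⊕ Fin n) K) :
    normalOrder K x d g * x k =
      x k * normalOrder K x d g + normalOrder K x d (MvPolynomial.pderiv (Sum.inr k) g) := by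
  induction g using MvPolynomial.induction_on' with
  | monomial e a =>
    rw [MvPolynomial.pderiv_monomial, normalOrder_monomial, normalOrder_monomial, smul_mul_assoc,
      h.weylMonomial_mul_x, smul_add, mul_smul_comm, mul_smul, Nat.cast_smul_eq_nsmul]
  | add g g' hg hg' => rw [map_add, map_add, map_add, mul_add, add_mul, hg, hg']; abel

theorem isMonomialFamily : IsMonomialFamily K (weylMonomial x d) := by
  refine isMonomialFamily_of_gen_mul (gen := Sum.elim x d) (weylMonomial_zero x d) fun w e => ?_
  cases w with
  | inl k => rw [Sum.elim_inl, h.x_mul_weylMonomial, sub_self]; exact zero_mem _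
  | inr k =>
    rw [Sum.elim_inr, h.d_mul_weylMonomial, h.weylMonomial_mul_d, add_sub_cancel_left]
    refine nsmul_mem (mem_lowerTerms (tsub_le_self.trans_lt ?_)) _
    exact lt_add_of_pos_left _ (by simp [pos_iff_ne_zero])

theorem union_range_subset_range_weylMonomial :
    Set.range x ∪ Set.range d ⊆ Set.range (weylMonomial x d) := by
  rintro _ (⟨k, rfl⟩ | ⟨k, rfl⟩)
  · exact ⟨Finsupp.single (Sum.inl k) 1 + 0, by
      rw [← h.x_mul_weylMonomial, weylMonomial_zero, mul_one]⟩
  · exact ⟨Finsupp.single (Sum.inr k) 1 + 0, by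
      rw [← h.weylMonomial_mul_d, weylMonomial_zero, one_mul]⟩

end WeylRelations

end WeylRelations

section BernsteinInequality

theorem eq_C_of_pderiv_eq_zero {σ R : Type*} [CommRing R] [NoZeroDivisors R] [CharZero R]
    {g : MvPolynomial σ R} (hg : ∀ w, MvPolynomial.pderiv w g = 0) :
    g = MvPolynomial.C (g.coeff 0) := by
  classical
  ext e
  rw [MvPolynomial.coeff_C]
  split_ifs with he
  · rw [he]
  obtain ⟨w, hw⟩ := Finsupp.ne_iff.1 (Ne.symm he)
  obtain ⟨e, rfl⟩ := exists_add_of_le (Finsupp.single_le_iff.2 (Nat.one_le_iff_ne_zero.2 hw))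
  have hcoeff := congrArg (MvPolynomial.coeff e) (hg w)
  rw [MvPolynomial.coeff_pderiv, MvPolynomial.coeff_zero, add_comm] at hcoeff
  exact (mul_eq_zero.1 hcoeff).resolve_right (Nat.cast_add_one_ne_zero (e w))

section Pderiv

variable {B V R : Type*} [DecidableEq B] [Fintype V] [CommSemiring R] {c : V → B} {r : B → ℕ}
  {w : V} {g : MvPolynomial V R}

theorem pderiv_mem_restrictSupport
    (hg : g ∈ MvPolynomial.restrictSupport R {e | multidegree c e ≤ r + Pi.single (c w) 1}) :
    MvPolynomial.pderiv w g ∈ MvPolynomial.restrictSupport R {e | multidegree c e ≤ r} := by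
  rw [MvPolynomial.mem_restrictSupport_iff] at hg ⊢
  intro e he
  rw [Finset.mem_coe, MvPolynomial.mem_support_iff, MvPolynomial.coeff_pderiv] at he
  have hle := hg (MvPolynomial.mem_support_iff.2 (left_ne_zero_of_mul he))
  rw [Set.mem_ofPred_eq, map_add, multidegree_single] at hle
  exact le_of_add_le_add_right hle

theorem pderiv_eq_zero_of_mem_restrictSupport
    (hg : g ∈ MvPolynomial.restrictSupport R {e | multidegree c e ≤ r}) (hw : r (c w) = 0) :
    MvPolynomial.pderiv w g = 0 := by
  refine MvPolynomial.pderiv_eq_zero_of_notMem_vars fun hmem => ?_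
  obtain ⟨e, he, hwe⟩ := (MvPolynomial.mem_vars_iff_mem_support w).1 hmem
  have hle := (le_multidegree c e w).trans ((MvPolynomial.mem_restrictSupport_iff R).1 hg he (c w))
  rw [hw, Nat.le_zero] at hle
  exact Finsupp.mem_support_iff.1 hwe hle

end Pderiv

variable {K R M ι B : Type*} [Field K] [Ring R] [AddCommGroup M] [Module R M] [Module K M]
  [DecidableEq B] {n : ℕ} {x d : Fin n → R} {b : Fin n → B} {f : ι → M} {r : B → ℕ}

theorem generator_mem_filtration (x d : Fin n → R) (c : Fin n ⊕ Fin n → B) (f : ι → M) (r : B → ℕ)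
    (i : ι) : f i ∈ filtration K (weylMonomial x d) c f r := by
  have hmem : weylMonomial x d 0 • f i ∈ filtration K (weylMonomial x d) c f r :=
    mon_smul_mem_filtration ((map_zero (multidegree c)).trans_le zero_le) i
  rwa [weylMonomial_zero, one_smul] at hmem

theorem filtration_weylMonomial_ne_bot (x d : Fin n → R) (c : Fin n ⊕ Fin n → B) {f : ι → M}
    {i : ι} (hf : f i ≠ 0) (r : B → ℕ) : filtration K (weylMonomial x d) c f r ≠ ⊥ :=
  (Submodule.ne_bot_iff _).2 ⟨f i, generator_mem_filtration x d c f r i, hf⟩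

variable [Algebra K R] [IsScalarTower K R M]

namespace WeylRelations

variable (h : WeylRelations x d)
include h

theorem x_smul_mem_filtration {y : M}
    (hy : y ∈ filtration K (weylMonomial x d) (Sum.elim b b) f r) (k : Fin n) :
    x k • y ∈ filtration K (weylMonomial x d) (Sum.elim b b) f (r + Pi.single (b k) 1) := by
  have hmem := h.isMonomialFamily.smul_mem_filtration hy (Finsupp.single (Sum.inl k) 1)
  rwa [multidegree_single, ← add_zero (Finsupp.single (Sum.inl k) 1), ← h.x_mul_weylMonomial,
    weylMonomial_zero, mul_one] at hmem

theorem d_smul_mem_filtration {y : M}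
    (hy : y ∈ filtration K (weylMonomial x d) (Sum.elim b b) f r) (k : Fin n) :
    d k • y ∈ filtration K (weylMonomial x d) (Sum.elim b b) f (r + Pi.single (b k) 1) := by
  have hmem := h.isMonomialFamily.smul_mem_filtration hy (Finsupp.single (Sum.inr k) 1)
  rwa [multidegree_single, ← add_zero (Finsupp.single (Sum.inr k) 1), ← h.weylMonomial_mul_d,
    weylMonomial_zero, one_mul] at hmem

theorem normalOrder_pderiv_smul_eq_zero {w : Fin n ⊕ Fin n} {g : MvPolynomial (Fin n ⊕ Fin n) K}
    (hg : ∀ y ∈ filtration K (weylMonomial x d) (Sum.elim b b) f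
      (r + Pi.single (Sum.elim b b w) 1), normalOrder K x d g • y = 0) {y : M}
    (hy : y ∈ filtration K (weylMonomial x d) (Sum.elim b b) f r) :
    normalOrder K x d (MvPolynomial.pderiv w g) • y = 0 := by
  have hzero : normalOrder K x d g • y = 0 :=
    hg y (filtration_mono _ f le_self_add hy)
  cases w with
  | inl k =>
    rw [← sub_eq_iff_eq_add'.2 (h.d_mul_normalOrder k g), sub_smul, mul_smul, mul_smul, hzero,
      hg _ (h.d_smul_mem_filtration hy k), smul_zero, sub_zero]
  | inr k =>
    rw [← sub_eq_iff_eq_add'.2 (h.normalOrder_mul_x k g), sub_smul, mul_smul, mul_smul, hzero,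
      hg _ (h.x_smul_mem_filtration hy k), smul_zero, sub_zero]

theorem eq_zero_of_normalOrder_smul_eq_zero [CharZero K] [Finite B] {i : ι} (hf : f i ≠ 0)
    (r : B → ℕ) {g : MvPolynomial (Fin n ⊕ Fin n) K}
    (hg : g ∈ MvPolynomial.restrictSupport K {e | multidegree (Sum.elim b b) e ≤ r})
    (hzero : ∀ y ∈ filtration K (weylMonomial x d) (Sum.elim b b) f r,
      normalOrder K x d g • y = 0) : g = 0 := by
  induction r using WellFoundedLT.induction generalizing g with
  | ind r ih =>
  have pderiv_eq_zero (w : Fin n ⊕ Fin n) : MvPolynomial.pderiv w g = 0 := by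
    by_cases hw : r (Sum.elim b b w) = 0
    · exact pderiv_eq_zero_of_mem_restrictSupport hg hw
    obtain ⟨r, rfl⟩ := exists_add_of_le (a := (Pi.single (Sum.elim b b w) 1 : B → ℕ))
      (update_le_iff.2 ⟨Nat.one_le_iff_ne_zero.2 hw, fun _ _ => zero_le⟩)
    rw [add_comm] at hg hzero
    exact ih r (lt_add_of_pos_left _ (by simp [pos_iff_ne_zero])) (pderiv_mem_restrictSupport hg)
      fun _ => h.normalOrder_pderiv_smul_eq_zero hzero
  rw [eq_C_of_pderiv_eq_zero pderiv_eq_zero] at hzero ⊢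
  have coeff_smul := hzero _ (generator_mem_filtration x d (Sum.elim b b) f r i)
  rw [MvPolynomial.C_apply, normalOrder_monomial, weylMonomial_zero, smul_assoc, one_smul]
    at coeff_smul
  rw [(smul_eq_zero.1 coeff_smul).resolve_right hf, map_zero]

theorem normalOrder_smul_mem_filtration {g : MvPolynomial (Fin n ⊕ Fin n) K} {r s : B → ℕ}
    (hg : g ∈ MvPolynomial.restrictSupport K {e | multidegree (Sum.elim b b) e ≤ s}) {y : M}
    (hy : y ∈ filtration K (weylMonomial x d) (Sum.elim b b) f r) :
    normalOrder K x d g • y ∈ filtration K (weylMonomial x d) (Sum.elim b b) f (r + s) := by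
  rw [g.as_sum, map_sum, Finset.sum_smul]
  refine sum_mem fun e he => ?_
  rw [normalOrder_monomial, smul_assoc]
  exact Submodule.smul_mem _ _ (filtration_mono _ f
    (add_le_add_right ((MvPolynomial.mem_restrictSupport_iff K).1 hg he) _)
    (h.isMonomialFamily.smul_mem_filtration hy e))

theorem card_exponentsLE_le_finrank_mul_finrank [CharZero K] [Finite B] [Finite ι] {i : ι}
    (hf : f i ≠ 0) (r : B → ℕ) : (exponentsLE (Sum.elim b b) r).card ≤
      Module.finrank K (filtration K (weylMonomial x d) (Sum.elim b b) f r) *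
        Module.finrank K (filtration K (weylMonomial x d) (Sum.elim b b) f (r + r)) := by
  let F := filtration K (weylMonomial x d) (Sum.elim b b) f
  let P := MvPolynomial.restrictSupport K {e | multidegree (Sum.elim b b) e ≤ r}
  let action : P →ₗ[K] F r →ₗ[K] F (r + r) := LinearMap.mk₂ K
    (fun g y => ⟨normalOrder K x d g • (y : M), h.normalOrder_smul_mem_filtration g.2 y.2⟩)
    (fun _ _ _ => Subtype.ext (by simp [add_smul])) (fun _ _ _ => Subtype.ext (by simp))
    (fun _ _ _ => Subtype.ext (by simp)) (fun _ _ _ => Subtype.ext (smul_comm _ _ _))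
  have injective : Function.Injective action := by
    refine (injective_iff_map_eq_zero action).2 fun g hg => Subtype.ext ?_
    exact h.eq_zero_of_normalOrder_smul_eq_zero hf r g.2 fun y hy =>
      congrArg Subtype.val (DFunLike.congr_fun hg (⟨y, hy⟩ : F r))
  calc (exponentsLE (Sum.elim b b) r).card
      = Module.finrank K P := by
        rw [Module.finrank_eq_nat_card_basis (MvPolynomial.basisRestrictSupport K _)]
        exact (Nat.subtype_card _ fun e => mem_exponentsLE).symm
    _ ≤ Module.finrank K (F r →ₗ[K] F (r + r)) :=
        LinearMap.finrank_le_finrank_of_injective injective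
    _ = Module.finrank K (F r) * Module.finrank K (F (r + r)) := Module.finrank_linearMap K K _ _

end WeylRelations

end BernsteinInequality

section Rays

open Filter

variable {p : ℕ}

/-- The restriction `q ↦ φ(s + q v)` of a polynomial to the ray from `s` in direction `v`. -/
def rayPoly (φ : MvPolynomial (Fin p) ℚ) (s v : Fin p → ℕ) : Polynomial ℚ :=
  MvPolynomial.aeval (fun i => Polynomial.C (s i : ℚ) + Polynomial.C (v i : ℚ) * Polynomial.X) φ

theorem eval_rayPoly (φ : MvPolynomial (Fin p) ℚ) (s v : Fin p → ℕ) (q : ℕ) :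
    (rayPoly φ s v).eval (q : ℚ) =
      MvPolynomial.eval (fun i => (((s + q • v) i : ℕ) : ℚ)) φ := by
  rw [rayPoly, ← Polynomial.coe_evalRingHom, MvPolynomial.aeval_def, MvPolynomial.hom_eval₂,
    MvPolynomial.eval, MvPolynomial.coe_eval₂Hom]
  congr 1
  · exact Subsingleton.elim _ _
  · ext i
    simp [mul_comm]

theorem natDegree_rayPoly_le_of_sum_le {φ : MvPolynomial (Fin p) ℚ} {t : ℕ} (s v : Fin p → ℕ)
    (h : ∀ e ∈ φ.support, ∑ i with v i ≠ 0, e i ≤ t) : (rayPoly φ s v).natDegree ≤ t := by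
  rw [rayPoly, MvPolynomial.aeval_def, MvPolynomial.eval₂_eq']
  refine Polynomial.natDegree_sum_le_of_forall_le _ _ fun e he => ?_
  refine (Polynomial.natDegree_C_mul_le _ _).trans ((Polynomial.natDegree_prod_le _ _).trans ?_)
  refine le_trans ?_ (h e he)
  rw [Finset.sum_filter]
  refine Finset.sum_le_sum fun i _ => Polynomial.natDegree_pow_le.trans ?_
  split_ifs with hv
  · exact (Nat.mul_le_mul_left _ (by compute_degree)).trans_eq (mul_one _)
  · simp [not_not.1 hv]

theorem natDegree_rayPoly_le_totalDegree (φ : MvPolynomial (Fin p) ℚ) (s v : Fin p → ℕ) :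
    (rayPoly φ s v).natDegree ≤ φ.totalDegree := by
  refine natDegree_rayPoly_le_of_sum_le s v fun e he => le_trans ?_ (MvPolynomial.le_totalDegree he)
  rw [Finsupp.sum_fintype _ _ fun _ => rfl]
  exact Finset.sum_le_sum_of_subset (Finset.filter_subset _ _)

theorem natDegree_rayPoly_single_le_degreeOf (φ : MvPolynomial (Fin p) ℚ) (s : Fin p → ℕ)
    (i : Fin p) : (rayPoly φ s (Pi.single i 1)).natDegree ≤ φ.degreeOf i :=
  natDegree_rayPoly_le_of_sum_le s _ fun e he => by
    simpa [Pi.single_apply, Finset.filter_eq'] using MvPolynomial.monomial_le_degreeOf i he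

theorem coeff_rayPoly_zero (φ : MvPolynomial (Fin p) ℚ) (v : Fin p → ℕ) (t : ℕ) :
    (rayPoly φ 0 v).coeff t =
      MvPolynomial.eval (fun i => (v i : ℚ)) (MvPolynomial.homogeneousComponent t φ) := by
  induction φ using MvPolynomial.induction_on' with
  | add φ ψ hφ hψ =>
    rw [rayPoly] at hφ hψ ⊢
    rw [map_add, Polynomial.coeff_add, hφ, hψ, map_add, map_add]
  | monomial e a =>
    have prod_line : (e.prod fun i k => (Polynomial.C ((0 : Fin p → ℕ) i : ℚ) +
        Polynomial.C (v i : ℚ) * Polynomial.X) ^ k) =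
        Polynomial.C (e.prod fun i k => (v i : ℚ) ^ k) * Polynomial.X ^ e.degree := by
      simp [mul_pow, Finsupp.prod, Finset.prod_mul_distrib, Finset.prod_pow_eq_pow_sum,
        Finsupp.degree_apply]
    rw [MvPolynomial.homogeneousComponent_of_mem (MvPolynomial.isHomogeneous_monomial a rfl),
      rayPoly, MvPolynomial.aeval_monomial, prod_line, ← mul_assoc, Polynomial.algebraMap_eq,
      ← Polynomial.C_mul, Polynomial.coeff_C_mul_X_pow, apply_ite (MvPolynomial.eval _),
      MvPolynomial.eval_monomial, map_zero]

theorem homogeneousComponent_totalDegree_ne_zero {σ R : Type*} [CommSemiring R]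
    {φ : MvPolynomial σ R} (hφ : φ ≠ 0) :
    MvPolynomial.homogeneousComponent φ.totalDegree φ ≠ 0 := by
  obtain ⟨e, he, hdeg⟩ := Finset.exists_mem_eq_sup _ (MvPolynomial.support_nonempty.2 hφ)
    Finsupp.degree
  replace hdeg : e.degree = φ.totalDegree := hdeg.symm
  refine fun hzero => MvPolynomial.mem_support_iff.1 he ?_
  have hcoeff := congrArg (MvPolynomial.coeff e) hzero
  rwa [MvPolynomial.coeff_homogeneousComponent, if_pos hdeg] at hcoeff

theorem exists_natDegree_rayPoly_eq_totalDegree (φ : MvPolynomial (Fin p) ℚ) :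
    ∃ v : Fin p → ℕ, (∀ i, 0 < v i) ∧ (rayPoly φ 0 v).natDegree = φ.totalDegree := by
  by_contra! hne
  have hlt (v : Fin p → ℕ) (hv : ∀ i, 0 < v i) : (rayPoly φ 0 v).natDegree < φ.totalDegree :=
    (natDegree_rayPoly_le_totalDegree φ 0 v).lt_of_ne (hne v hv)
  have hφ : φ ≠ 0 := by
    rintro rfl
    simpa using hlt 1 fun _ => one_pos
  refine homogeneousComponent_totalDegree_ne_zero hφ ?_
  refine MvPolynomial.funext_set (fun _ => Set.range fun k : ℕ => ((k + 1 : ℕ) : ℚ))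
    (fun _ => Set.infinite_range_of_injective fun k l h => by simpa using h) fun y hy => ?_
  choose k hk using fun i => hy i (Set.mem_univ i)
  obtain rfl : (fun i => ((k i + 1 : ℕ) : ℚ)) = y := funext hk
  rw [← coeff_rayPoly_zero, map_zero]
  exact Polynomial.coeff_eq_zero_of_natDegree_lt (hlt _ fun i => Nat.succ_pos (k i))

theorem natDegree_le_of_eventually_le {P Q : Polynomial ℚ}
    (h : ∀ᶠ q : ℕ in atTop, 0 < P.eval (q : ℚ) ∧ P.eval (q : ℚ) ≤ Q.eval (q : ℚ)) :
    P.natDegree ≤ Q.natDegree := by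
  by_contra! hlt
  have hquot := (Polynomial.div_tendsto_atTop_zero_of_degree_lt Q P
    (Polynomial.degree_lt_degree hlt)).comp (tendsto_natCast_atTop_atTop (R := ℚ))
  obtain ⟨q, hq, hpos, hle⟩ := ((hquot.eventually (gt_mem_nhds one_pos)).and h).exists
  rw [Function.comp_apply, div_lt_one hpos] at hq
  exact hle.not_gt hq

theorem tendsto_add_smul_atTop (s : Fin p → ℕ) {v : Fin p → ℕ} (hv : ∀ i, 0 < v i) :
    Tendsto (fun q : ℕ => s + q • v) atTop atTop :=
  tendsto_atTop.2 fun r => by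
    filter_upwards [eventually_ge_atTop (∑ i, r i)] with q hq i
    calc r i ≤ ∑ i, r i := Finset.single_le_sum (fun _ _ => Nat.zero_le _) (Finset.mem_univ i)
      _ ≤ q * v i := hq.trans (Nat.le_mul_of_pos_right q (hv i))
      _ ≤ (s + q • v) i := Nat.le_add_left _ _

theorem totalDegree_le_natDegree_of_eventually_le {φ : MvPolynomial (Fin p) ℚ} {ψ : Polynomial ℚ}
    (a : ℕ) (h : ∀ᶠ r : Fin p → ℕ in atTop, 0 < MvPolynomial.eval (fun i => (r i : ℚ)) φ ∧
      MvPolynomial.eval (fun i => (r i : ℚ)) φ ≤ ψ.eval ((a + ∑ i, r i : ℕ) : ℚ)) :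
    φ.totalDegree ≤ ψ.natDegree := by
  obtain ⟨v, hv, hdeg⟩ := exists_natDegree_rayPoly_eq_totalDegree φ
  let line : Polynomial ℚ := Polynomial.C (a : ℚ) + Polynomial.C ((∑ i, v i : ℕ) : ℚ) * Polynomial.X
  have eval_line (q : ℕ) : line.eval (q : ℚ) = ((a + ∑ i, (0 + q • v) i : ℕ) : ℚ) := by
    simp [line, Polynomial.eval_finsetSum, Finset.mul_sum, mul_comm]
  have hle : φ.totalDegree ≤ (ψ.comp line).natDegree := by
    rw [← hdeg]
    refine natDegree_le_of_eventually_le ?_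
    filter_upwards [(tendsto_add_smul_atTop 0 hv).eventually h] with q hq
    rwa [eval_rayPoly, Polynomial.eval_comp, eval_line]
  have natDegree_line : line.natDegree ≤ 1 := by
    unfold line
    compute_degree
  calc φ.totalDegree ≤ ψ.natDegree * line.natDegree := by rwa [← Polynomial.natDegree_comp]
    _ ≤ ψ.natDegree := (Nat.mul_le_mul_left _ natDegree_line).trans_eq (mul_one _)

end Rays

section HilbertPolynomial

open Filter

variable {K M : Type*} [Field K] [AddCommGroup M] [Module K M] {p : ℕ}

/-- `φ` is the Hilbert polynomial of the multifiltration `F`: its values at all large `r` are the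
dimensions of `F r`. -/
def IsHilbertPolynomial (F : (Fin p → ℕ) → Submodule K M) (φ : MvPolynomial (Fin p) ℚ) : Prop :=
  ∀ᶠ r in atTop, MvPolynomial.eval (fun i => (r i : ℚ)) φ = (Module.finrank K (F r) : ℚ)

namespace IsHilbertPolynomial

variable {F : (Fin p → ℕ) → Submodule K M} {φ : MvPolynomial (Fin p) ℚ}
  [∀ r, Module.Finite K (F r)]

theorem eventually_pos (h : IsHilbertPolynomial F φ) (hF : ∀ r, F r ≠ ⊥) :
    ∀ᶠ r : Fin p → ℕ in atTop, 0 < MvPolynomial.eval (fun i => (r i : ℚ)) φ :=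
  Eventually.mono h fun r hr => by
    rw [hr, Nat.cast_pos]
    exact Submodule.one_le_finrank_iff.2 (hF r)

theorem ne_zero (h : IsHilbertPolynomial F φ) (hF : ∀ r, F r ≠ ⊥) : φ ≠ 0 := by
  rintro rfl
  obtain ⟨r, hr⟩ := (h.eventually_pos hF).exists
  simp at hr

theorem exists_finrank_le_eval_rayPoly (h : IsHilbertPolynomial F φ) (hF : Monotone F)
    (s : Fin p → ℕ) : ∃ s', ∀ v (q : ℕ),
      (Module.finrank K (F (s + q • v)) : ℚ) ≤ (rayPoly φ s' v).eval (q : ℚ) := by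
  obtain ⟨t, ht⟩ := eventually_atTop.1 h
  refine ⟨s + t, fun v q => ?_⟩
  rw [eval_rayPoly, ht _ (le_add_of_le_of_nonneg le_add_self zero_le), Nat.cast_le]
  exact Submodule.finrank_mono (hF (by gcongr; exact le_self_add))

theorem natDegree_le_totalDegree (h : IsHilbertPolynomial F φ) (hF : Monotone F)
    {ψ : Polynomial ℚ} (s : Fin p → ℕ) (hψ : ∀ᶠ q : ℕ in atTop, 0 < ψ.eval (q : ℚ) ∧
      ψ.eval (q : ℚ) ≤ (Module.finrank K (F (s + q • 1)) : ℚ)) :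
    ψ.natDegree ≤ φ.totalDegree := by
  obtain ⟨s', hs'⟩ := h.exists_finrank_le_eval_rayPoly hF s
  exact (natDegree_le_of_eventually_le (hψ.mono fun q hq => ⟨hq.1, hq.2.trans (hs' 1 q)⟩)).trans
    (natDegree_rayPoly_le_totalDegree φ s' 1)

end IsHilbertPolynomial

end HilbertPolynomial

section BernsteinDegree

open Filter

theorem pow_le_mul_card_exponentsLE {V B : Type*} [Fintype V] [Fintype B] [DecidableEq B]
    (c : V → B) (v : B → ℕ) (q : ℕ) :
    (q + 1) ^ ∑ j with v j ≠ 0, (Finset.univ.filter fun w => c w = j).card ≤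
      (∏ j, (Finset.univ.filter fun w => c w = j).card.factorial) *
        (exponentsLE c (q • v)).card := by
  rw [card_exponentsLE, ← Finset.prod_mul_distrib, ← Finset.prod_pow_eq_pow_sum,
    Finset.prod_filter]
  refine Finset.prod_le_prod' fun j _ => ?_
  rw [← Nat.ascFactorial_eq_factorial_mul_choose]
  split_ifs with hj
  · have succ_le : q + 1 ≤ (q • v) j + 1 :=
      Nat.succ_le_succ (Nat.le_mul_of_pos_right q (Nat.pos_of_ne_zero hj))
    exact (Nat.pow_le_pow_left succ_le _).trans (Nat.pow_succ_le_ascFactorial _ _)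
  · exact Nat.ascFactorial_pos _ _

theorem card_filter_sumElim_self {n p : ℕ} (b : Fin n → Fin p) (j : Fin p) :
    (Finset.univ.filter fun w => Sum.elim b b w = j).card = 2 * blockSize b j := by
  simp only [Finset.card_filter, Fintype.sum_sum_type, blockSize, two_mul, Sum.elim_inl,
    Sum.elim_inr]
  rfl

variable {K R M ι : Type*} [Field K] [CharZero K] [Ring R] [Algebra K R] [AddCommGroup M]
  [Module R M] [Module K M] [IsScalarTower K R M] [Finite ι] {n p : ℕ} {x d : Fin n → R}

theorem WeylRelations.exists_sum_blockSize_le_natDegree_rayPoly (h : WeylRelations x d)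
    {b : Fin n → Fin p} {f : ι → M} {i : ι} (hf : f i ≠ 0) {φ : MvPolynomial (Fin p) ℚ}
    (hφ : IsHilbertPolynomial (filtration K (weylMonomial x d) (Sum.elim b b) f) φ)
    (v : Fin p → ℕ) : ∃ s, ∑ j with v j ≠ 0, blockSize b j ≤ (rayPoly φ s v).natDegree := by
  obtain ⟨s, hs⟩ := hφ.exists_finrank_le_eval_rayPoly (filtration_mono _ f) 0
  refine ⟨s, ?_⟩
  set P := rayPoly φ s v
  set k := ∑ j with v j ≠ 0, blockSize b j
  have finrank_le (q : ℕ) : (Module.finrank K (filtration K (weylMonomial x d) (Sum.elim b b) f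
      (q • v)) : ℚ) ≤ P.eval (q : ℚ) := zero_add (q • v) ▸ hs v q
  let a : ℕ := ∏ j, (2 * blockSize b j).factorial
  have pow_le (q : ℕ) : ((q : ℚ) + 1) ^ (2 * k) ≤ a * (P.eval (q : ℚ) * P.eval (2 * q : ℚ)) := by
    have hcard := pow_le_mul_card_exponentsLE (Sum.elim b b) v q
    simp only [card_filter_sumElim_self, ← Finset.mul_sum] at hcard
    have hdim := hcard.trans
      (Nat.mul_le_mul_left a (h.card_exponentsLE_le_finrank_mul_finrank (K := K) hf _))
    rw [← two_smul ℕ (q • v), smul_smul] at hdim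
    calc ((q : ℚ) + 1) ^ (2 * k) ≤ a * (Module.finrank K (filtration K _ _ f (q • v)) *
          Module.finrank K (filtration K _ _ f ((2 * q) • v))) := by exact_mod_cast hdim
      _ ≤ a * (P.eval (q : ℚ) * P.eval (2 * q : ℚ)) := by
        have := finrank_le (2 * q)
        push_cast at this
        exact mul_le_mul_of_nonneg_left (mul_le_mul (finrank_le q) this (Nat.cast_nonneg _)
          ((Nat.cast_nonneg _).trans (finrank_le q))) (Nat.cast_nonneg _)
  have natDegree_le := calc
    2 * k = ((Polynomial.X + Polynomial.C (1 : ℚ)) ^ (2 * k)).natDegree := by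
        rw [Polynomial.natDegree_pow, Polynomial.natDegree_X_add_C, mul_one]
    _ ≤ (Polynomial.C (a : ℚ) * (P * P.comp (Polynomial.C 2 * Polynomial.X))).natDegree :=
        natDegree_le_of_eventually_le (Eventually.of_forall fun q => by
          simpa using ⟨by positivity, pow_le q⟩)
    _ ≤ P.natDegree + (P.comp (Polynomial.C 2 * Polynomial.X)).natDegree :=
        (Polynomial.natDegree_C_mul_le _ _).trans Polynomial.natDegree_mul_le
    _ = 2 * P.natDegree := by
        rw [Polynomial.natDegree_comp, Polynomial.natDegree_C_mul_X _ two_ne_zero]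
        ring
  exact Nat.le_of_mul_le_mul_left natDegree_le two_pos

theorem WeylRelations.blockSize_le_degreeOf (h : WeylRelations x d)
    {b : Fin n → Fin p} {f : ι → M} {i : ι} (hf : f i ≠ 0) {φ : MvPolynomial (Fin p) ℚ}
    (hφ : IsHilbertPolynomial (filtration K (weylMonomial x d) (Sum.elim b b) f) φ)
    (j : Fin p) : blockSize b j ≤ φ.degreeOf j := by
  obtain ⟨s, hs⟩ := h.exists_sum_blockSize_le_natDegree_rayPoly hf hφ (Pi.single j 1)
  calc blockSize b j = ∑ k with (Pi.single j 1 : Fin p → ℕ) k ≠ 0, blockSize b k := by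
        simp [Pi.single_apply, Finset.filter_eq']
    _ ≤ φ.degreeOf j := hs.trans (natDegree_rayPoly_single_le_degreeOf φ s j)

theorem sum_blockSize (b : Fin n → Fin p) : ∑ j, blockSize b j = n := by
  simpa [blockSize] using (Finset.card_eq_sum_card_fiberwise (s := Finset.univ) (f := b)
    fun k _ => Finset.mem_coe.2 (Finset.mem_univ (b k))).symm

theorem WeylRelations.le_totalDegree (h : WeylRelations x d)
    {b : Fin n → Fin p} {f : ι → M} {i : ι} (hf : f i ≠ 0) {φ : MvPolynomial (Fin p) ℚ}
    (hφ : IsHilbertPolynomial (filtration K (weylMonomial x d) (Sum.elim b b) f) φ) :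
    n ≤ φ.totalDegree := by
  obtain ⟨s, hs⟩ := h.exists_sum_blockSize_le_natDegree_rayPoly hf hφ 1
  calc n = ∑ k with (1 : Fin p → ℕ) k ≠ 0, blockSize b k := by simp [sum_blockSize]
    _ ≤ φ.totalDegree := hs.trans (natDegree_rayPoly_le_totalDegree φ s 1)

end BernsteinDegree

namespace WeylAlgebra

variable (K : Type*) [Field K] {n : ℕ}

theorem weylRelations : WeylRelations (x K (n := n)) (d K) where
  x_commute _ _ := Subtype.ext (LinearMap.ext fun _ => mul_left_comm _ _ _)
  d_commute k l := by
    have bracket_eq_zero : ⁅(MvPolynomial.pderiv k : Derivation K (MvPolynomial (Fin n) K) _),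
        (MvPolynomial.pderiv l : Derivation K (MvPolynomial (Fin n) K) _)⁆ = 0 :=
      MvPolynomial.derivation_ext fun i => by
        simp [Derivation.commutator_apply, MvPolynomial.pderiv_X, Pi.single_apply, apply_ite]
    have apply_eq_zero g := DFunLike.congr_fun bracket_eq_zero g
    simp only [Derivation.commutator_apply] at apply_eq_zero
    exact Subtype.ext (LinearMap.ext fun g => sub_eq_zero.1 (apply_eq_zero g))
  d_mul_x k l := by
    refine Subtype.ext (LinearMap.ext fun g => ?_)
    have leibniz : MvPolynomial.pderiv k (MvPolynomial.X l * g) =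
        MvPolynomial.X l * MvPolynomial.pderiv k g + if k = l then g else 0 := by
      simp [Derivation.leibniz, MvPolynomial.pderiv_X, Pi.single_apply, eq_comm (a := l)]
    refine leibniz.trans ?_
    split_ifs <;> rfl

theorem span_range_weylMonomial :
    Submodule.span K (Set.range (weylMonomial (x K (n := n)) (d K))) = ⊤ := by
  have adjoin_eq_top : Algebra.adjoin K (Set.range (x K (n := n)) ∪ Set.range (d K)) = ⊤ :=
    eq_top_mono (Algebra.adjoin_mono (by
      rintro ⟨_, _⟩ (⟨k, rfl⟩ | ⟨k, rfl⟩)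
      exacts [.inl ⟨k, rfl⟩, .inr ⟨k, rfl⟩])) Algebra.adjoin_adjoin_coe_preimage
  have adjoin_le := (weylRelations K (n := n)).isMonomialFamily.adjoin_le_span (K := K)
    (weylMonomial_zero _ _) (weylRelations K).union_range_subset_range_weylMonomial
  rwa [adjoin_eq_top, Algebra.top_toSubmodule, top_le_iff] at adjoin_le

variable {M : Type*} [AddCommGroup M] [Module (WeylAlgebra K n) M] [Module K M]
  [IsScalarTower K (WeylAlgebra K n) M] {p m : ℕ}

/-- The filtration of the module generated by the `f i` by the order in each block of variables. -/
abbrev blockFiltration (b : Fin n → Fin p) (f : Fin m → M) (r : Fin p → ℕ) : Submodule K M :=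
  filtration K (weylMonomial (x K) (d K)) (Sum.elim b b) f r

theorem multidegree_sumElim_self (b : Fin n → Fin p) (e : Fin n ⊕ Fin n →₀ ℕ) (j : Fin p) :
    multidegree (Sum.elim b b) e j = blockOrd b j (e ∘ Sum.inl) (e ∘ Sum.inr) := by
  rw [multidegree_apply, Finset.sum_filter, Fintype.sum_sum_type, blockOrd,
    Finset.sum_add_distrib, Finset.sum_filter, Finset.sum_filter]
  rfl

theorem sumSmul_span_le {S : Set (WeylAlgebra K n)} {f : Fin m → M} {P : Submodule K M} :
    sumSmul K (Submodule.span K S) f ≤ P ↔ ∀ a ∈ S, ∀ i, a • f i ∈ P := by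
  simp only [sumSmul, iSup_le_iff, Submodule.map_span_le]
  exact forall_comm.trans (forall_congr' fun _ => forall_comm)

theorem multiM_natCast (b : Fin n → Fin p) (f : Fin m → M) (r : Fin p → ℕ) :
    multiM K b f (fun j => (r j : ℤ)) = blockFiltration K b f r := by
  refine eq_of_forall_ge_iff fun P => ?_
  rw [multiM, multiW, sumSmul_span_le, filtration_le]
  constructor
  · intro h e he
    exact h _ ⟨_, _, fun j => Nat.cast_le.2 (multidegree_sumElim_self b e j ▸ he j), rfl⟩
  · rintro h _ ⟨α, β, hr, rfl⟩
    refine h (Finsupp.equivFunOnFinite.symm (Sum.elim α β)) fun j => ?_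
    rw [multidegree_sumElim_self]
    exact Nat.cast_le.1 (hr j)

theorem multiW_one_block (r : Fin 1 → ℤ) :
    multiW K (fun _ : Fin n => (0 : Fin 1)) r = bernsteinW K n (r 0) := by
  simp [multiW, bernsteinW, ord, blockOrd, Fin.forall_fin_one]

theorem sumSmul_bernsteinW_natCast (f : Fin m → M) (r : ℕ) :
    sumSmul K (bernsteinW K n (r : ℤ)) f =
      blockFiltration K (fun _ : Fin n => (0 : Fin 1)) f fun _ => r := by
  rw [← multiM_natCast, multiM, multiW_one_block]

end WeylAlgebra

theorem exists_ne_zero_of_span_range_eq_top {R M ι : Type*} [Semiring R] [AddCommMonoid M]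
    [Module R M] [Nontrivial M] {f : ι → M} (hf : Submodule.span R (Set.range f) = ⊤) :
    ∃ i, f i ≠ 0 := by
  by_contra! h
  refine bot_ne_top (α := Submodule R M) (hf ▸ (Submodule.span_eq_bot.2 ?_).symm)
  exact Set.forall_mem_range.2 h

section Holonomic

open Filter

variable {K : Type*} [Field K] {n : ℕ} {M : Type*} [AddCommGroup M] [Module (WeylAlgebra K n) M]
  [Module K M] [IsScalarTower K (WeylAlgebra K n) M] {p m : ℕ}

namespace WeylAlgebra

variable (K) in
theorem exists_isHilbertPolynomial (b : Fin n → Fin p) (f : Fin m → M) :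
    ∃ φ ∈ binomSpan fun i => 2 * blockSize b i, IsHilbertPolynomial (blockFiltration K b f) φ := by
  obtain ⟨φ, φ_mem, hφ⟩ := (weylRelations K (n := n)).isMonomialFamily (K := K)
    |>.finrank_filtration_mem_eventuallyBinomial (Sum.elim b b) f
  simp only [card_filter_sumElim_self] at φ_mem
  exact ⟨φ, φ_mem, hφ.mono fun r hr => hr.trans (Int.cast_natCast _)⟩

theorem isBernsteinPolynomial_iff {g : Fin m → M} {ψ : Polynomial ℚ} :
    IsBernsteinPolynomial K (n := n) g ψ ↔ ∀ᶠ r : ℕ in atTop, ψ.eval (r : ℚ) =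
      (Module.finrank K (blockFiltration K (fun _ : Fin n => (0 : Fin 1)) g fun _ => r) : ℚ) := by
  constructor
  · rintro ⟨r₀, h⟩
    filter_upwards [eventually_ge_atTop r₀.toNat] with r hr
    rw [← sumSmul_bernsteinW_natCast, ← h _ (Int.toNat_le.1 hr), Int.cast_natCast]
  · intro h
    obtain ⟨r₀, h⟩ := eventually_atTop.1 h
    refine ⟨r₀, fun r hr => ?_⟩
    lift r to ℕ using (Int.natCast_nonneg _).trans hr
    rw [sumSmul_bernsteinW_natCast, Int.cast_natCast, h r (Nat.cast_le.1 hr)]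

theorem IsBernsteinPolynomial.eventually_pos {g : Fin m → M} {ψ : Polynomial ℚ}
    (h : IsBernsteinPolynomial K (n := n) g ψ) {i : Fin m} (hg : g i ≠ 0) :
    ∀ᶠ r : ℕ in atTop, 0 < ψ.eval (r : ℚ) := by
  filter_upwards [isBernsteinPolynomial_iff.1 h] with r hr
  rw [hr, Nat.cast_pos]
  exact Submodule.one_le_finrank_iff.2 (filtration_weylMonomial_ne_bot _ _ _ hg _)

theorem exists_isBernsteinPolynomial (f : Fin m → M) :
    ∃ ψ : Polynomial ℚ, IsBernsteinPolynomial K (n := n) f ψ := by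
  obtain ⟨φ, -, hφ⟩ := exists_isHilbertPolynomial K (fun _ : Fin n => (0 : Fin 1)) f
  refine ⟨rayPoly φ 0 1, isBernsteinPolynomial_iff.2 ?_⟩
  filter_upwards [(tendsto_add_smul_atTop 0 (v := 1) fun _ => one_pos).eventually hφ] with r hr
  have ray_eq : 0 + r • (1 : Fin 1 → ℕ) = fun _ => r := by ext; simp
  rw [eval_rayPoly, hr, ray_eq]

end WeylAlgebra

open WeylAlgebra

namespace IsHilbertPolynomial

variable {b : Fin n → Fin p} {f : Fin m → M} {φ : MvPolynomial (Fin p) ℚ}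

theorem natDegree_bernstein_le (hφ : IsHilbertPolynomial (blockFiltration K b f) φ)
    (hf : Submodule.span (WeylAlgebra K n) (Set.range f) = ⊤) {l : ℕ} {g : Fin l → M}
    {i : Fin l} (hg : g i ≠ 0) {ψ : Polynomial ℚ}
    (hψ : IsBernsteinPolynomial K (n := n) g ψ) : ψ.natDegree ≤ φ.totalDegree := by
  obtain ⟨s, hs⟩ := (weylRelations K).isMonomialFamily.exists_filtration_le (Sum.elim b b)
    (span_range_weylMonomial K) hf g
  refine hφ.natDegree_le_totalDegree (filtration_mono _ f) s ?_
  filter_upwards [hψ.eventually_pos hg, isBernsteinPolynomial_iff.1 hψ] with q hpos hq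
  refine ⟨hpos, hq.trans_le (Nat.cast_le.2 (Submodule.finrank_mono ?_))⟩
  refine (filtration_unique_le_filtration (Sum.elim b b) _ g q).trans ((hs _).trans ?_)
  exact filtration_mono _ f (by simp [Pi.le_def])

theorem totalDegree_le_natDegree_bernstein (hφ : IsHilbertPolynomial (blockFiltration K b f) φ)
    {i : Fin m} (hf : f i ≠ 0) {l : ℕ} {g : Fin l → M}
    (hg : Submodule.span (WeylAlgebra K n) (Set.range g) = ⊤) {ψ : Polynomial ℚ}
    (hψ : IsBernsteinPolynomial K (n := n) g ψ) : φ.totalDegree ≤ ψ.natDegree := by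
  obtain ⟨s, hs⟩ := (weylRelations K).isMonomialFamily.exists_filtration_le
    (Sum.elim (fun _ => 0) fun _ => (0 : Fin 1)) (span_range_weylMonomial K) hg f
  obtain ⟨t, ht⟩ := eventually_atTop.1 (isBernsteinPolynomial_iff.1 hψ)
  refine totalDegree_le_natDegree_of_eventually_le (s 0 + t) ?_
  filter_upwards [hφ.eventually_pos (filtration_weylMonomial_ne_bot _ _ _ hf), hφ] with r hpos hr
  refine ⟨hpos, ?_⟩
  rw [hr, ht _ (by lia), Nat.cast_le]
  refine Submodule.finrank_mono ?_
  calc blockFiltration K b f r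
      ≤ blockFiltration K (fun _ : Fin n => (0 : Fin 1)) f fun _ => ∑ i, r i :=
        filtration_le_filtration_of_unique _ _ f r
    _ ≤ _ := (hs _).trans (filtration_mono _ g fun j => by
        rw [Subsingleton.elim j 0]
        exact Nat.add_le_add_right (Nat.le_add_right _ _) _)

theorem isHolonomic_iff [Nontrivial M] (hφ : IsHilbertPolynomial (blockFiltration K b f) φ)
    (hf : Submodule.span (WeylAlgebra K n) (Set.range f) = ⊤) :
    IsHolonomic K n M ↔ φ.totalDegree = n := by
  obtain ⟨i, hfi⟩ := exists_ne_zero_of_span_range_eq_top hf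
  constructor
  · rintro ⟨l, g, hg, ψ, hψ, hdeg⟩
    obtain ⟨j, hgj⟩ := exists_ne_zero_of_span_range_eq_top hg
    rw [← Polynomial.natDegree_eq_of_degree_eq_some hdeg]
    exact le_antisymm (hφ.totalDegree_le_natDegree_bernstein hfi hg hψ)
      (hφ.natDegree_bernstein_le hf hgj hψ)
  · intro hn
    obtain ⟨ψ, hψ⟩ := exists_isBernsteinPolynomial (K := K) (n := n) f
    have ψ_ne_zero : ψ ≠ 0 := by
      rintro rfl
      obtain ⟨r, hr⟩ := (hψ.eventually_pos hfi).exists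
      simp at hr
    refine ⟨m, f, hf, ψ, hψ, ?_⟩
    rw [Polynomial.degree_eq_natDegree ψ_ne_zero, ← hn]
    exact congrArg _ (le_antisymm (hφ.natDegree_bernstein_le hf hfi hψ)
      (hφ.totalDegree_le_natDegree_bernstein hfi hf hψ))

theorem exists_forall_eval_eq_finrank_multiM
    (hφ : IsHilbertPolynomial (blockFiltration K b f) φ) :
    ∃ s : Fin p → ℤ, ∀ r : Fin p → ℤ, s ≤ r → Module.Finite K (multiM K b f r) ∧
      MvPolynomial.eval (fun i => (r i : ℚ)) φ = (Module.finrank K (multiM K b f r) : ℚ) := by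
  obtain ⟨s, hs⟩ := eventually_atTop.1 hφ
  refine ⟨fun i => s i, fun r hr => ?_⟩
  lift r to Fin p → ℕ using fun i => (Int.natCast_nonneg _).trans (hr i)
  rw [multiM_natCast]
  exact ⟨inferInstance, by simpa using hs r fun i => Nat.cast_le.1 (hr i)⟩

end IsHilbertPolynomial

end Holonomic

end

theorem theorem4p2 {K : Type*} [Field K] [CharZero K] {n p m : ℕ} (b : Fin n → Fin p)
    {M : Type*} [AddCommGroup M] [Module (WeylAlgebra K n) M] [Module K M]
    [IsScalarTower K (WeylAlgebra K n) M] [Nontrivial M]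
    (f : Fin m → M) (hf : Submodule.span (WeylAlgebra K n) (Set.range f) = ⊤) :
    ∃ φ : MvPolynomial (Fin p) ℚ, φ ≠ 0 ∧ IsNumerical φ ∧
      (∃ s : Fin p → ℤ, ∀ r : Fin p → ℤ, s ≤ r →
        Module.Finite K ↥(WeylAlgebra.multiM K b f r) ∧
        MvPolynomial.eval (fun i => (r i : ℚ)) φ =
          (Module.finrank K ↥(WeylAlgebra.multiM K b f r) : ℚ)) ∧
      (∀ i : Fin p, blockSize b i ≤ φ.degreeOf i ∧ φ.degreeOf i ≤ 2 * blockSize b i) ∧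
      (n ≤ φ.totalDegree ∧ φ.totalDegree ≤ 2 * n) ∧
      (∃ a : (Fin p → ℕ) → ℤ,
        φ = ∑ k ∈ Fintype.piFinset (fun i => Finset.range (2 * blockSize b i + 1)),
          MvPolynomial.C (a k : ℚ) * ∏ i, binomPoly i (k i)) ∧
      (WeylAlgebra.IsHolonomic K n M ↔ φ.totalDegree = n) := by
  obtain ⟨i, hfi⟩ := exists_ne_zero_of_span_range_eq_top hf
  obtain ⟨φ, φ_mem, hφ⟩ := WeylAlgebra.exists_isHilbertPolynomial K b f
  have hrel := WeylAlgebra.weylRelations K (n := n)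
  have degreeOf_le := degreeOf_le_of_mem_binomSpan φ_mem
  have totalDegree_le : φ.totalDegree ≤ 2 * n := calc
    φ.totalDegree ≤ ∑ j, φ.degreeOf j := totalDegree_le_sum_degreeOf φ
    _ ≤ ∑ j, 2 * blockSize b j := Finset.sum_le_sum fun j _ => degreeOf_le j
    _ = 2 * n := by rw [← Finset.mul_sum, sum_blockSize]
  obtain ⟨s, hs⟩ := hφ.exists_forall_eval_eq_finrank_multiM
  have isNumerical : IsNumerical φ :=
    ⟨s, fun r hr => ⟨_, (hs r hr).2.trans (Int.cast_natCast _).symm⟩⟩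
  exact ⟨φ, hφ.ne_zero (filtration_weylMonomial_ne_bot _ _ _ hfi), isNumerical, ⟨s, hs⟩,
    fun j => ⟨hrel.blockSize_le_degreeOf hfi hφ j, degreeOf_le j⟩,
    ⟨hrel.le_totalDegree hfi hφ, totalDegree_le⟩, mem_binomSpan_iff.1 φ_mem,
    hφ.isHolonomic_iff hf⟩
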